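/- Let $n,m\ge 1$ and $k\ge 0$ be integers, $L,r>0$ with $nLr\ge 2$, and let $G:B^k(r)\to\mathbb{R}^n$ be $L$-Lipschitz on $B^k(r)=\{z\in\mathbb{R}^k:\|z\|_2\le r\}$ with $\mathrm{Range}(G)\subseteq\mathcal{S}^{n-1}$ (the unit sphere). Let $x\in\mathrm{Range}(G)$. Let $(a_i,y_i)$, $i=1,\dots,m$, be i.i.d. copies of $(a,y)$, where $a\sim\mathcal{N}(0,I_n)$ and $y=f(a^Tx)$ for a possibly random measurable link function $f:\mathbb{R}\to\mathbb{R}$ whose randomness is independent of $a$. Assume that $y$ is sub-exponential with $K_y:=\|y\|_{\psi_1}=\sup_{p\ge1}p^{-1}(\mathbb{E}|y|^p)^{1/p}<\infty$, and that $\nu:=\mathrm{Cov}[y,(a^Tx)^2]>0$. Put $V=\frac1m\sum_{i=1}^m y_i(a_ia_i^T-I_n)$, and let $\mathcal{P}_G(s)$ be a point $G(z)$ with $z\in\arg\min_{z'\in B^k(r)}\|G(z')-s\|_2$. The projected power method from a starting point $w^{(0)}\in\mathbb{R}^n$ is $w^{(t+1)}=\mathcal{P}_G(Vw^{(t)})$,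 $t=0,1,2,\dots$. There is an absolute constant $C>0$, and for every $c_0>0$ there is a constant $C_1>0$ depending only on $c_0$, $K_y$ and $\nu$, such that, if $$m\ \ge\ C_1\,(k\log(nLr))\cdot(\log m),$$ then with probability at least $1-C/m$ the following holds for all starting points $w^{(0)}$ (possibly depending on the data) and all choices of the minimizers in the projections: whenever $x^Tw^{(t_0)}\ge c_0$ for some integer $t_0\ge1$, every $t>t_0$ satisfies $$\|w^{(t)}-x\|_2\ \le\ \frac{C\,K_y}{\nu\,c_0}\sqrt{\frac{(k\log(nLr))\cdot(\log m)}{m}} .$$ -/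

import Mathlib

open MeasureTheory ProbabilityTheory
open scoped ENNReal NNReal RealInnerProductSpace

/-- The sub-exponential norm `sup_{p ≥ 1} p⁻¹ (𝔼|X|^p)^{1/p}` of a random variable, as an extended
nonnegative number; `X` is sub-exponential exactly when it is finite. -/
noncomputable def subexpNorm {Ω : Type*} [MeasurableSpace Ω] (X : Ω → ℝ) (P : Measure Ω) : ℝ≥0∞ :=
  ⨆ (p : ℝ) (_ : 1 ≤ p), (ENNReal.ofReal p)⁻¹ * eLpNorm X (ENNReal.ofReal p) P

/-- The observation `f(aᵀx)` of a single index model. The possibly random link function is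
represented as `f : ℝ → S → ℝ`, its second argument being the randomness (noise) of the link. -/
noncomputable def simObs {n : ℕ} {S : Type*} (f : ℝ → S → ℝ) (x : EuclideanSpace ℝ (Fin n))
    (q : EuclideanSpace ℝ (Fin n) × S) : ℝ :=
  f ⟪q.1, x⟫ q.2

/-- The joint law of a standard Gaussian sensing vector in `ℝⁿ` and an independent noise variable
of law `ρ`. -/
noncomputable def simLaw (n : ℕ) {S : Type*} [MeasurableSpace S] (ρ : Measure S) :
    Measure (EuclideanSpace ℝ (Fin n) × S) :=
  (stdGaussian (EuclideanSpace ℝ (Fin n))).prod ρ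

/-- The data matrix `V = (1/m) ∑ᵢ yᵢ (aᵢ aᵢᵀ - I)`. -/
noncomputable def spectralMatrix {n m : ℕ} (a : Fin m → EuclideanSpace ℝ (Fin n))
    (y : Fin m → ℝ) : Matrix (Fin n) (Fin n) ℝ :=
  (1 / (m : ℝ)) • ∑ i, y i • (Matrix.vecMulVec (a i).ofLp (a i).ofLp - 1)

/-- `w` is a projection of `s` onto the range of `G` on the closed ball of radius `r`:
`w = G z` for a minimizer `z` of `‖G z - s‖` over that ball. -/
def IsRangeProj {k n : ℕ} (G : EuclideanSpace ℝ (Fin k) → EuclideanSpace ℝ (Fin n)) (r : ℝ)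
    (s w : EuclideanSpace ℝ (Fin n)) : Prop :=
  ∃ z ∈ Metric.closedBall (0 : EuclideanSpace ℝ (Fin k)) r,
    IsMinOn (fun z' => ‖G z' - s‖) (Metric.closedBall 0 r) z ∧ w = G z

/-- `w` is a run of the projected power method with matrix `V`:
`w (t + 1) = P_G (V (w t))` for all `t`, from an arbitrary starting point `w 0`. -/
def IsProjPowerSeq {k n : ℕ} (G : EuclideanSpace ℝ (Fin k) → EuclideanSpace ℝ (Fin n)) (r : ℝ)
    (V : Matrix (Fin n) (Fin n) ℝ) (w : ℕ → EuclideanSpace ℝ (Fin n)) : Prop :=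
  ∀ t, IsRangeProj G r (Matrix.toEuclideanLin V (w t)) (w (t + 1))

/-!
The power method converges after one step because the optimality of a projection onto a subset of
the sphere is a one-sided inequality: if `w'` is the projection of `V w` and `x` lies in the range,
then `0 ≤ ⟪w' - x, V w⟫` (`IsRangeProj.inner_nonneg`). The expectation of `V` is `ν x xᵀ`
(`integral_mul_quadratic_eq_covariance`), and `⟪w' - x, x⟫ = -‖w' - x‖² / 2`, so the inequality says
`ν ⟪x, w⟫ ‖w' - x‖² / 2 ≤ ⟪w' - x, (V - ν x xᵀ) w⟫`. With `s² = q = k log (n L r) log m / m`, it is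
therefore enough to bound the right-hand side by a multiple of `Ky (s ‖w' - x‖ + s²)`, uniformly
over the range (`norm_sub_le_of_isRangeProj`). Then `‖w' - x‖` is of order `Ky s / (ν c₀)`; for a
sample size with this at most `1`, the correlation of `w'` with `x` is at least `1 / 2`, and the
argument repeats at every later step.

The uniform bound needs a net of the range at the single scale `q / n`, of at most
`(1 + 2 n L r / q) ^ k` points by a volume argument. No chaining is needed: a change of the points
by `q / n` costs at most `‖V‖ q / n`, which is of order `Ky q` by the crude estimate
`‖V‖ ≤ m⁻¹ ∑ |yᵢ| (‖aᵢ‖² + 1)`, of order `Ky n`. On the net, the bound is relative to `‖u - x‖`.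

For one pair of unit vectors the summands `yᵢ Qᵢ`, with `Qᵢ = ⟪aᵢ, u⟫ ⟪aᵢ, v⟫ - ⟪u, v⟫`, are
products of two sub-exponential variables and have no exponential moment. With probability
`1 - 1 / m`, however, all `|yᵢ|` are at most `B = 6 Ky log m`, and for the truncated observations
the moment generating function satisfies a Bernstein bound in which `B` limits the range of
parameters while the variance proxy is of order `Ky²` (`HasFourthMoment.mgf_mul_le`). The truncation
moves the mean by at most order `Ky / m`. Chernoff's bound at the deviation `Ky s` has exponent of
order `m s min (s, 1 / log m)`, and this dominates the entropy `2 k log (1 + 2 n L r / q) + log m`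
(`two_mul_entropy_add_log_le`); that is where the factor `log m` of the rate is spent.
-/

/-! ### Bernstein bound for the product of a bounded and a sub-exponential variable -/

/-- `Q` is sub-exponential at the fixed scale `1/4`: `𝔼 exp(|Q|/4) ≤ 2`. -/
structure HasExpMoment {E : Type*} [MeasurableSpace E] (Q : E → ℝ) (P : Measure E) : Prop where
  measurable : Measurable Q
  integrable : Integrable (fun e => Real.exp (|Q e| / 4)) P
  le_two : ∫ e, Real.exp (|Q e| / 4) ∂P ≤ 2

/-- The fourth moment of `Y` is at most `D ^ 4`. -/
structure HasFourthMoment {E : Type*} [MeasurableSpace E] (Y : E → ℝ) (D : ℝ) (P : Measure E) :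
    Prop where
  measurable : Measurable Y
  integrable : Integrable (fun e => Y e ^ 4) P
  le_pow : ∫ e, Y e ^ 4 ∂P ≤ D ^ 4

section Moments

variable {E : Type*} [MeasurableSpace E] {P : Measure E} {Y Q : E → ℝ} {D : ℝ}

lemma abs_pow_four_le_exp_div_eight (x : ℝ) : x ^ 4 ≤ 98304 * Real.exp (|x| / 8) := by
  have h := Real.pow_div_factorial_le_exp (x := |x| / 8) (by positivity) 4
  have : x ^ 4 = |x| ^ 4 := (Even.pow_abs (by decide) x).symm
  rw [this]
  norm_num [Nat.factorial] at h
  have : (|x| / 8) ^ 4 = |x| ^ 4 / 4096 := by ring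
  rw [this] at h
  have h2 : |x| ^ 4 / 4096 / 24 = |x| ^ 4 / 98304 := by ring
  rw [h2] at h
  linarith

lemma pow_four_le_exp_div_four (x : ℝ) : x ^ 4 ≤ 6144 * Real.exp (|x| / 4) := by
  have h := Real.pow_div_factorial_le_exp (x := |x| / 4) (by positivity) 4
  have : x ^ 4 = |x| ^ 4 := (Even.pow_abs (by decide) x).symm
  rw [this]
  norm_num [Nat.factorial] at h
  have : (|x| / 4) ^ 4 = |x| ^ 4 / 256 := by ring
  rw [this] at h
  linarith

lemma sq_le_exp_div_four (x : ℝ) : x ^ 2 ≤ 32 * Real.exp (|x| / 4) := by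
  have h := Real.pow_div_factorial_le_exp (x := |x| / 4) (by positivity) 2
  have : x ^ 2 = |x| ^ 2 := (sq_abs x).symm
  rw [this]
  norm_num [Nat.factorial] at h
  have : (|x| / 4) ^ 2 = |x| ^ 2 / 16 := by ring
  rw [this] at h
  linarith

lemma exp_le_one_add_self_add_sq_mul_exp_abs (x : ℝ) :
    Real.exp x ≤ 1 + x + x ^ 2 * Real.exp |x| := by
  have h := Complex.norm_exp_sub_sum_le_norm_mul_exp (x : ℂ) 2
  have e : Complex.exp (x : ℂ) - ∑ m ∈ Finset.range 2, (x : ℂ) ^ m / (m.factorial : ℂ)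
      = ((Real.exp x - (1 + x) : ℝ) : ℂ) := by
    simp [Finset.sum_range_succ]
  rw [e, Complex.norm_real, Complex.norm_real, Real.norm_eq_abs, Real.norm_eq_abs, sq_abs] at h
  linarith [le_abs_self (Real.exp x - (1 + x))]

lemma HasExpMoment.integrable_pow_four (hQ : HasExpMoment Q P) :
    Integrable (fun e => Q e ^ 4) P := by
  refine (hQ.integrable.const_mul 6144).mono' (hQ.measurable.pow_const 4).aestronglyMeasurable ?_
  refine Filter.Eventually.of_forall fun e => ?_
  rw [Real.norm_eq_abs, abs_of_nonneg (by positivity)]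
  exact pow_four_le_exp_div_four _

lemma HasExpMoment.integral_pow_four_le (hQ : HasExpMoment Q P) :
    ∫ e, Q e ^ 4 ∂P ≤ 12288 := by
  have h := integral_mono hQ.integrable_pow_four (hQ.integrable.const_mul 6144)
    (fun e => pow_four_le_exp_div_four (Q e))
  simp only [integral_const_mul] at h
  linarith [hQ.le_two]

lemma HasExpMoment.integrable_sq (hQ : HasExpMoment Q P) :
    Integrable (fun e => Q e ^ 2) P := by
  refine (hQ.integrable.const_mul 32).mono' (hQ.measurable.pow_const 2).aestronglyMeasurable ?_
  refine Filter.Eventually.of_forall fun e => ?_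
  rw [Real.norm_eq_abs, abs_of_nonneg (by positivity)]
  exact sq_le_exp_div_four _

lemma HasExpMoment.integral_sq_le (hQ : HasExpMoment Q P) : ∫ e, Q e ^ 2 ∂P ≤ 64 := by
  have h := integral_mono hQ.integrable_sq (hQ.integrable.const_mul 32)
    (fun e => sq_le_exp_div_four (Q e))
  simp only [integral_const_mul] at h
  linarith [hQ.le_two]

lemma HasExpMoment.integrable_exp_mul {B lam : ℝ} (hB : ∀ e, |Y e| ≤ B) (hlam : 0 ≤ lam)
    (hlB : lam * B ≤ 1 / 16) (hYm : Measurable Y) (hQ : HasExpMoment Q P) :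
    Integrable (fun e => Real.exp (lam * (Y e * Q e))) P := by
  refine hQ.integrable.mono' ((hYm.mul hQ.measurable).const_mul lam).exp.aestronglyMeasurable ?_
  refine Filter.Eventually.of_forall fun e => ?_
  rw [Real.norm_eq_abs, abs_of_nonneg (by positivity)]
  apply Real.exp_le_exp.2
  calc lam * (Y e * Q e) ≤ |lam * (Y e * Q e)| := le_abs_self _
    _ = lam * |Y e| * |Q e| := by rw [abs_mul, abs_mul, abs_of_nonneg hlam, mul_assoc]
    _ ≤ lam * B * |Q e| := by gcongr; exact hB e
    _ ≤ 1 / 16 * |Q e| := by gcongr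
    _ ≤ |Q e| / 4 := by linarith [abs_nonneg (Q e)]

variable [IsProbabilityMeasure P]

lemma HasFourthMoment.integrable_sq (hY : HasFourthMoment Y D P) :
    Integrable (fun e => Y e ^ 2) P := by
  refine (hY.integrable.add (integrable_const 1)).mono'
    (hY.measurable.pow_const 2).aestronglyMeasurable ?_
  refine Filter.Eventually.of_forall fun e => ?_
  rw [Real.norm_eq_abs, abs_of_nonneg (by positivity)]
  simp only [Pi.add_apply]
  nlinarith [sq_nonneg (Y e ^ 2 - 1), sq_nonneg (Y e)]

lemma HasFourthMoment.integral_sq_le (hD : 0 < D) (hY : HasFourthMoment Y D P) :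
    ∫ e, Y e ^ 2 ∂P ≤ D ^ 2 := by
  have h := integral_mono hY.integrable_sq
    ((hY.integrable.const_mul (1 / (2 * D ^ 2))).add (integrable_const (D ^ 2 / 2)))
    (fun e => by
      simp only [Pi.add_apply]
      have h2 : 0 ≤ (Y e ^ 2 - D ^ 2) ^ 2 / (2 * D ^ 2) := by positivity
      have h3 : (Y e ^ 2 - D ^ 2) ^ 2 / (2 * D ^ 2)
        = 1 / (2 * D ^ 2) * Y e ^ 4 + D ^ 2 / 2 - Y e ^ 2 := by field_simp; ring
      linarith)
  simp only [Pi.add_apply] at h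
  rw [integral_add (hY.integrable.const_mul _) (integrable_const _), integral_const_mul] at h
  simp only [integral_const, probReal_univ, smul_eq_mul, one_mul] at h
  have h4 : 1 / (2 * D ^ 2) * ∫ e, Y e ^ 4 ∂P ≤ 1 / (2 * D ^ 2) * D ^ 4 := by
    gcongr; exact hY.le_pow
  have h5 : 1 / (2 * D ^ 2) * D ^ 4 = D ^ 2 / 2 := by field_simp
  linarith

lemma HasFourthMoment.integrable_mul (hY : HasFourthMoment Y D P) (hQ : HasExpMoment Q P) :
    Integrable (fun e => Y e * Q e) P := by
  refine (hY.integrable_sq.add hQ.integrable_sq).mono'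
    (hY.measurable.mul hQ.measurable).aestronglyMeasurable ?_
  refine Filter.Eventually.of_forall fun e => ?_
  rw [Real.norm_eq_abs, abs_le]
  simp only [Pi.add_apply]
  constructor <;> nlinarith [sq_nonneg (Y e - Q e), sq_nonneg (Y e + Q e),
    sq_nonneg (Y e), sq_nonneg (Q e)]

lemma HasFourthMoment.integral_abs_mul_le (hD : 0 < D) (hY : HasFourthMoment Y D P)
    (hQ : HasExpMoment Q P) : ∫ e, |Y e * Q e| ∂P ≤ 33 * D := by
  have h := integral_mono (hY.integrable_mul hQ).abs
    ((hY.integrable_sq.const_mul (1 / (2 * D))).add (hQ.integrable_sq.const_mul (D / 2)))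
    (fun e => by
      simp only [Pi.add_apply]
      have h2 : 0 ≤ (|Y e| - D * |Q e|) ^ 2 / (2 * D) := by positivity
      have h3 : (|Y e| - D * |Q e|) ^ 2 / (2 * D)
        = 1 / (2 * D) * |Y e| ^ 2 + D / 2 * |Q e| ^ 2 - |Y e| * |Q e| := by field_simp; ring
      rw [sq_abs, sq_abs] at h3
      rw [abs_mul]
      linarith)
  simp only [Pi.add_apply] at h
  rw [integral_add (hY.integrable_sq.const_mul _) (hQ.integrable_sq.const_mul _),
    integral_const_mul, integral_const_mul] at h
  have h4 : 1 / (2 * D) * ∫ e, Y e ^ 2 ∂P ≤ 1 / (2 * D) * D ^ 2 := by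
    gcongr; exact hY.integral_sq_le hD
  have h5 : 1 / (2 * D) * D ^ 2 = D / 2 := by field_simp
  have h6 : D / 2 * ∫ e, Q e ^ 2 ∂P ≤ D / 2 * 64 := by
    gcongr; exact hQ.integral_sq_le
  linarith

/-- Cutting `Y` off on an event of small probability changes `𝔼[Y Q]` only a little. -/
lemma HasFourthMoment.integral_indicator_abs_mul_le (hD : 0 < D) (hY : HasFourthMoment Y D P)
    (hQ : HasExpMoment Q P) {A : Set E} (hA : MeasurableSet A) {δ : ℝ} (hδ : 0 < δ)
    (hPA : P.real A ≤ δ ^ 2) :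
    ∫ e, A.indicator (fun e => |Y e * Q e|) e ∂P ≤ 3100 * D * δ := by
  have i1 : Integrable (A.indicator (fun _ => (1 : ℝ))) P := (integrable_const 1).indicator hA
  have i12 : Integrable (fun e => D / (2 * δ) * A.indicator (fun _ => (1 : ℝ)) e
      + δ / (4 * D ^ 3) * Y e ^ 4) P := (i1.const_mul _).add (hY.integrable.const_mul _)
  have h := integral_mono ((hY.integrable_mul hQ).abs.indicator hA)
    (i12.add (hQ.integrable_pow_four.const_mul (δ * D / 4)))
    (fun e => by
      simp only [Pi.add_apply]
      by_cases he : e ∈ A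
      · simp only [Set.indicator_of_mem he]
        have h2 : 0 ≤ (|Y e * Q e| - D / δ) ^ 2 * (δ / (2 * D)) := by positivity
        have h3 : (|Y e * Q e| - D / δ) ^ 2 * (δ / (2 * D))
          = δ / (2 * D) * |Y e * Q e| ^ 2 + D / (2 * δ) - |Y e * Q e| := by field_simp; ring
        rw [sq_abs] at h3
        have h4 : 0 ≤ (Y e ^ 2 - D ^ 2 * Q e ^ 2) ^ 2 * (δ / (4 * D ^ 3)) := by positivity
        have h5 : (Y e ^ 2 - D ^ 2 * Q e ^ 2) ^ 2 * (δ / (4 * D ^ 3))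
          = δ / (4 * D ^ 3) * Y e ^ 4 + δ * D / 4 * Q e ^ 4 - δ / (2 * D) * (Y e * Q e) ^ 2 := by
          field_simp; ring
        linarith
      · simp only [Set.indicator_of_notMem he]
        positivity)
  simp only [Pi.add_apply] at h
  rw [integral_add i12 (hQ.integrable_pow_four.const_mul _),
    integral_add (i1.const_mul _) (hY.integrable.const_mul _),
    integral_const_mul, integral_const_mul, integral_const_mul] at h
  rw [integral_indicator_const _ hA, smul_eq_mul, mul_one] at h
  have h3 : D / (2 * δ) * P.real A ≤ D / (2 * δ) * δ ^ 2 := by gcongr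
  have h3' : D / (2 * δ) * δ ^ 2 = D * δ / 2 := by field_simp
  have h4 : δ / (4 * D ^ 3) * ∫ e, Y e ^ 4 ∂P ≤ δ / (4 * D ^ 3) * D ^ 4 := by
    gcongr; exact hY.le_pow
  have h5 : δ / (4 * D ^ 3) * D ^ 4 = D * δ / 4 := by field_simp
  have h6 : δ * D / 4 * ∫ e, Q e ^ 4 ∂P ≤ δ * D / 4 * 12288 := by
    gcongr; exact hQ.integral_pow_four_le
  nlinarith [mul_pos hD hδ]

/-- The Bernstein-type bound for the moment generating function of a product of a bounded variable
and a sub-exponential one: the range of admissible `lam` is governed by the bound `B`, while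
the variance proxy only sees the fourth moment of `Y`. -/
lemma HasFourthMoment.mgf_mul_le {B lam : ℝ} (hD : 0 < D) (hB : ∀ e, |Y e| ≤ B) (hlam : 0 ≤ lam)
    (hlB : lam * B ≤ 1 / 16) (hY : HasFourthMoment Y D P) (hQ : HasExpMoment Q P) :
    mgf (fun e => Y e * Q e) P lam
      ≤ Real.exp (lam * ∫ e, Y e * Q e ∂P + 100000 * lam ^ 2 * D ^ 2) := by
  have hint := hQ.integrable_exp_mul (P := P) hB hlam hlB hY.measurable
  have key : ∀ e, Real.exp (lam * (Y e * Q e)) ≤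
      ((1 + lam * (Y e * Q e)) + lam ^ 2 / (2 * D ^ 2) * Y e ^ 4)
        + lam ^ 2 * D ^ 2 * 49152 * Real.exp (|Q e| / 4) := by
    intro e
    refine (exp_le_one_add_self_add_sq_mul_exp_abs _).trans ?_
    have h1 : |lam * (Y e * Q e)| ≤ |Q e| / 16 := by
      calc |lam * (Y e * Q e)| = lam * |Y e| * |Q e| := by
            rw [abs_mul, abs_mul, abs_of_nonneg hlam, mul_assoc]
        _ ≤ lam * B * |Q e| := by gcongr; exact hB e
        _ ≤ 1 / 16 * |Q e| := by gcongr
        _ = |Q e| / 16 := by ring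
    set z := Real.exp (|Q e| / 16) with hz
    have hz0 : 0 < z := Real.exp_pos _
    have h2 : Real.exp |lam * (Y e * Q e)| ≤ z := Real.exp_le_exp.2 h1
    have hz2 : z ^ 2 = Real.exp (|Q e| / 8) := by
      rw [hz, ← Real.exp_nat_mul]; congr 1; push_cast; ring
    have hz4 : z ^ 2 * z ^ 2 = Real.exp (|Q e| / 4) := by
      rw [hz2, ← Real.exp_add]; congr 1; ring
    have h3 : Q e ^ 4 ≤ 98304 * z ^ 2 := by rw [hz2]; exact abs_pow_four_le_exp_div_eight _
    have h4 : (lam * (Y e * Q e)) ^ 2 * Real.exp |lam * (Y e * Q e)|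
        ≤ (lam * (Y e * Q e)) ^ 2 * z := by gcongr
    -- the inequality of arithmetic and geometric means separates `Y` from `Q`
    have h5 : 0 ≤ lam ^ 2 * ((Y e ^ 2 - D ^ 2 * (Q e ^ 2 * z)) ^ 2 / (2 * D ^ 2)) := by positivity
    have h6 : lam ^ 2 * ((Y e ^ 2 - D ^ 2 * (Q e ^ 2 * z)) ^ 2 / (2 * D ^ 2))
      = lam ^ 2 / (2 * D ^ 2) * Y e ^ 4 + lam ^ 2 * D ^ 2 / 2 * (Q e ^ 4 * z ^ 2)
        - (lam * (Y e * Q e)) ^ 2 * z := by field_simp; ring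
    have h7 : Q e ^ 4 * z ^ 2 ≤ 98304 * Real.exp (|Q e| / 4) := by
      rw [← hz4]; nlinarith [sq_nonneg z]
    have h8 : lam ^ 2 * D ^ 2 / 2 * (Q e ^ 4 * z ^ 2)
      ≤ lam ^ 2 * D ^ 2 / 2 * (98304 * Real.exp (|Q e| / 4)) := by gcongr
    linarith
  have i1 : Integrable (fun e => 1 + lam * (Y e * Q e)) P :=
    (integrable_const 1).add ((hY.integrable_mul hQ).const_mul lam)
  have i2 := hY.integrable.const_mul (lam ^ 2 / (2 * D ^ 2))
  have i3 := hQ.integrable.const_mul (lam ^ 2 * D ^ 2 * 49152)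
  have i12 : Integrable (fun e => (1 + lam * (Y e * Q e)) + lam ^ 2 / (2 * D ^ 2) * Y e ^ 4) P :=
    i1.add i2
  have h := integral_mono hint (i12.add i3) key
  simp only [Pi.add_apply] at h
  rw [integral_add i12 i3, integral_add i1 i2,
    integral_add (integrable_const 1) ((hY.integrable_mul hQ).const_mul lam),
    integral_const_mul, integral_const_mul, integral_const_mul] at h
  simp only [integral_const, probReal_univ, smul_eq_mul, one_mul] at h
  have h4 : lam ^ 2 / (2 * D ^ 2) * ∫ e, Y e ^ 4 ∂P ≤ lam ^ 2 / (2 * D ^ 2) * D ^ 4 := by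
    gcongr; exact hY.le_pow
  have h5 : lam ^ 2 / (2 * D ^ 2) * D ^ 4 = lam ^ 2 * D ^ 2 / 2 := by field_simp
  have h6 : lam ^ 2 * D ^ 2 * 49152 * ∫ e, Real.exp (|Q e| / 4) ∂P
      ≤ lam ^ 2 * D ^ 2 * 49152 * 2 := by gcongr; exact hQ.le_two
  have h7 : 0 ≤ lam ^ 2 * D ^ 2 := by positivity
  refine h.trans ?_
  refine le_trans ?_ (Real.add_one_le_exp _)
  linarith

end Moments

/-! ### Quadratic forms of a standard Gaussian vector -/

section Gaussian

lemma integral_exp_sq_div_four_gaussianReal :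
    ∫ z, Real.exp (z ^ 2 / 4) ∂(gaussianReal 0 1) = √2 := by
  rw [integral_gaussianReal_eq_integral_smul one_ne_zero]
  have : ∀ z : ℝ, gaussianPDFReal 0 1 z • Real.exp (z ^ 2 / 4)
      = (√(2 * Real.pi))⁻¹ * Real.exp (-(1 / 4) * z ^ 2) := by
    intro z
    simp only [gaussianPDFReal, NNReal.coe_one, mul_one, sub_zero, smul_eq_mul]
    rw [mul_assoc, ← Real.exp_add]
    congr 2; ring
  simp_rw [this]
  rw [integral_const_mul, integral_gaussian, ← Real.sqrt_inv, ← Real.sqrt_mul (by positivity)]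
  congr 1
  field_simp
  norm_num

variable {E : Type*} [NormedAddCommGroup E] [InnerProductSpace ℝ E] [FiniteDimensional ℝ E]
  [MeasurableSpace E] [BorelSpace E]

lemma integral_inner_stdGaussian (u : E) : ∫ a, ⟪a, u⟫ ∂(stdGaussian E) = 0 := by
  have h := integral_strongDual_stdGaussian (innerSL ℝ u)
  simpa [real_inner_comm] using h

lemma memLp_inner_stdGaussian (u : E) (p : ℝ≥0∞) (hp : p ≠ ∞) :
    MemLp (fun a => ⟪a, u⟫) p (stdGaussian E) := by
  have h := IsGaussian.memLp_dual (stdGaussian E) (innerSL ℝ u) p hp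
  refine h.congr_norm (by fun_prop) (Filter.Eventually.of_forall fun a => ?_)
  simp [real_inner_comm]

lemma covariance_inner_stdGaussian (u v : E) :
    cov[fun a => ⟪a, u⟫, fun a => ⟪a, v⟫; stdGaussian E] = ⟪u, v⟫ := by
  have h := covarianceBilin_apply (μ := stdGaussian E) (IsGaussian.memLp_two_id) u v
  rw [covarianceBilin_stdGaussian, innerSL_apply_apply] at h
  rw [covariance, integral_inner_stdGaussian, integral_inner_stdGaussian]
  simpa [real_inner_comm] using h.symm

lemma integral_inner_mul_inner_stdGaussian (u v : E) :
    ∫ a, ⟪a, u⟫ * ⟪a, v⟫ ∂(stdGaussian E) = ⟪u, v⟫ := by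
  rw [← covariance_inner_stdGaussian, covariance_eq_sub (memLp_inner_stdGaussian u 2 (by simp))
    (memLp_inner_stdGaussian v 2 (by simp)), integral_inner_stdGaussian]
  simp

lemma map_inner_stdGaussian {u : E} (hu : ‖u‖ = 1) :
    (stdGaussian E).map (fun a => ⟪a, u⟫) = gaussianReal 0 1 := by
  have hG : HasGaussianLaw (fun a : E => ⟪a, u⟫) (stdGaussian E) := by
    have h := (IsGaussian.hasGaussianLaw_id (μ := stdGaussian E)).map (innerSL ℝ u)
    refine h.congr (Filter.Eventually.of_forall fun a => ?_)
    simp [real_inner_comm]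
  have hv : Var[fun a => ⟪a, u⟫; stdGaussian E] = 1 := by
    rw [← covariance_self (by fun_prop), covariance_inner_stdGaussian]
    simp [hu]
  rw [hG.map_eq_gaussianReal, integral_inner_stdGaussian, hv]
  simp

lemma integrable_exp_inner_sq {u : E} (hu : ‖u‖ = 1) :
    Integrable (fun a => Real.exp (⟪a, u⟫ ^ 2 / 4)) (stdGaussian E) := by
  have h : Integrable (fun z : ℝ => Real.exp (z ^ 2 / 4)) (gaussianReal 0 1) := by
    -- the integral is nonzero, so it is not the junk value of a non-integrable function
    by_contra hn
    have := integral_undef hn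
    rw [integral_exp_sq_div_four_gaussianReal] at this
    have : (0 : ℝ) < √2 := by positivity
    linarith
  rw [← map_inner_stdGaussian hu] at h
  exact h.comp_measurable (by fun_prop)

lemma integral_exp_inner_sq {u : E} (hu : ‖u‖ = 1) :
    ∫ a, Real.exp (⟪a, u⟫ ^ 2 / 4) ∂(stdGaussian E) = √2 := by
  rw [← integral_exp_sq_div_four_gaussianReal, ← map_inner_stdGaussian hu,
    integral_map (by fun_prop) (by fun_prop)]

lemma exp_quarter_mul_sqrt_two_le : Real.exp (1 / 4) * √2 ≤ 2 := by
  have h1 : Real.exp (1 / 4) ≤ √2 := by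
    apply Real.le_sqrt_of_sq_le
    rw [← Real.exp_nat_mul]
    have h2 : Real.exp ((2 : ℕ) * (1 / 4)) ^ 2 ≤ 4 := by
      rw [← Real.exp_nat_mul]
      norm_num
      linarith [Real.exp_one_lt_d9]
    exact abs_le_of_sq_le_sq' (by linarith) (by norm_num) |>.2
  calc Real.exp (1 / 4) * √2 ≤ √2 * √2 := by gcongr
    _ = 2 := Real.mul_self_sqrt (by norm_num)

/-- A function that is dominated by `1` plus an average of squares of standard Gaussians is
sub-exponential: by convexity its exponential moment is at most `e^(1/4) 𝔼 e^(g²/4) = e^(1/4) √2`. -/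
lemma hasExpMoment_of_abs_le {ι : Type*} [Fintype ι] [Nonempty ι] {Q : E → ℝ} (hQ : Measurable Q)
    (u : ι → E) (hu : ∀ i, ‖u i‖ = 1)
    (h : ∀ a, |Q a| ≤ 1 + ∑ i, (Fintype.card ι : ℝ)⁻¹ * ⟪a, u i⟫ ^ 2) :
    HasExpMoment Q (stdGaussian E) := by
  have hc : (0 : ℝ) < Fintype.card ι := by exact_mod_cast Fintype.card_pos
  have key : ∀ a, Real.exp (|Q a| / 4) ≤
      Real.exp (1 / 4) * ∑ i, (Fintype.card ι : ℝ)⁻¹ * Real.exp (⟪a, u i⟫ ^ 2 / 4) := by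
    intro a
    have h1 : |Q a| / 4 ≤ 1 / 4 + ∑ i, (Fintype.card ι : ℝ)⁻¹ • (⟪a, u i⟫ ^ 2 / 4) := by
      have : ∑ i, (Fintype.card ι : ℝ)⁻¹ • (⟪a, u i⟫ ^ 2 / 4)
          = (∑ i, (Fintype.card ι : ℝ)⁻¹ * ⟪a, u i⟫ ^ 2) / 4 := by
        rw [Finset.sum_div]; simp [mul_div_assoc]
      rw [this]; linarith [h a]
    refine (Real.exp_le_exp.2 h1).trans ?_
    rw [Real.exp_add]
    gcongr
    have := convexOn_exp.map_sum_le (t := Finset.univ) (w := fun _ : ι => (Fintype.card ι : ℝ)⁻¹)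
      (p := fun i => ⟪a, u i⟫ ^ 2 / 4) (fun _ _ => by positivity)
      (by simp [hc.ne']) (fun _ _ => Set.mem_univ _)
    simpa using this
  have hi : Integrable (fun a => Real.exp (1 / 4) *
      ∑ i, (Fintype.card ι : ℝ)⁻¹ * Real.exp (⟪a, u i⟫ ^ 2 / 4)) (stdGaussian E) :=
    (integrable_finsetSum _ fun i _ => (integrable_exp_inner_sq (hu i)).const_mul _).const_mul _
  have hint : Integrable (fun e => Real.exp (|Q e| / 4)) (stdGaussian E) := by
    refine hi.mono' (hQ.abs.div_const 4).exp.aestronglyMeasurable ?_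
    refine Filter.Eventually.of_forall fun a => ?_
    rw [Real.norm_eq_abs, abs_of_nonneg (by positivity)]
    exact key a
  refine ⟨hQ, hint, (integral_mono hint hi key).trans ?_⟩
  rw [integral_const_mul, integral_finsetSum _ fun i _ =>
    (integrable_exp_inner_sq (hu i)).const_mul _]
  simp_rw [integral_const_mul, integral_exp_inner_sq (hu _)]
  simpa [hc.ne'] using exp_quarter_mul_sqrt_two_le

lemma hasExpMoment_inner_mul_inner_sub {u v : E} (hu : ‖u‖ = 1) (hv : ‖v‖ = 1) :
    HasExpMoment (fun a => ⟪a, u⟫ * ⟪a, v⟫ - ⟪u, v⟫) (stdGaussian E) := by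
  refine hasExpMoment_of_abs_le (ι := Fin 2) (by fun_prop) ![u, v]
    (by intro i; fin_cases i <;> simp [hu, hv]) fun a => ?_
  simp only [Fin.sum_univ_two, Matrix.cons_val_zero, Matrix.cons_val_one, Fintype.card_fin]
  have h1 : |⟪u, v⟫| ≤ 1 := by
    have := abs_real_inner_le_norm u v
    rwa [hu, hv, one_mul] at this
  rw [abs_le] at h1 ⊢
  push_cast
  constructor <;> nlinarith [sq_nonneg (⟪a, u⟫ - ⟪a, v⟫), sq_nonneg (⟪a, u⟫ + ⟪a, v⟫)]

lemma hasExpMoment_norm_sq {n : ℕ} (hn : 1 ≤ n) :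
    HasExpMoment (fun a : EuclideanSpace ℝ (Fin n) => (‖a‖ ^ 2 + 1) / n) (stdGaussian _) := by
  have : Nonempty (Fin n) := ⟨⟨0, hn⟩⟩
  have hn' : (1 : ℝ) ≤ n := by exact_mod_cast hn
  refine hasExpMoment_of_abs_le (by fun_prop) (fun i => EuclideanSpace.single i (1 : ℝ))
    (by simp) fun a => ?_
  rw [abs_of_nonneg (by positivity), ← Finset.mul_sum, EuclideanSpace.real_norm_sq_eq]
  simp only [EuclideanSpace.inner_single_right, Fintype.card_fin]
  simp only [one_mul, conj_trivial]
  rw [add_div, inv_mul_eq_div, add_comm]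
  gcongr
  rw [div_le_one (by linarith)]; exact hn'

/-- The component of a standard Gaussian vector along a unit vector `x` is independent of the
component orthogonal to `x`. -/
lemma indepFun_inner_sub_inner_smul {x : E} (hx : ‖x‖ = 1) :
    IndepFun (fun a => ⟪a, x⟫) (fun a => a - ⟪a, x⟫ • x) (stdGaussian E) := by
  apply HasGaussianLaw.indepFun_of_covariance_inner
  · let T : E →L[ℝ] ℝ × E := (innerSL ℝ x).prod
      (ContinuousLinearMap.id ℝ E - (innerSL ℝ x).smulRight x)
    have h := (IsGaussian.hasGaussianLaw_id (μ := stdGaussian E)).map T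
    refine h.congr (Filter.Eventually.of_forall fun a => ?_)
    simp [T, real_inner_comm]
  · intro c y
    have h1 : (fun a : E => ⟪c, ⟪a, x⟫⟫) = fun a => c * ⟪a, x⟫ := by
      ext a; simp [mul_comm]
    have h2 : (fun a : E => ⟪y, a - ⟪a, x⟫ • x⟫) = fun a => ⟪a, y - ⟪y, x⟫ • x⟫ := by
      ext a
      simp only [inner_sub_right, real_inner_smul_right, real_inner_comm a y]
      ring
    rw [h1, h2, covariance_const_mul_left, covariance_inner_stdGaussian]
    simp [inner_sub_right, real_inner_smul_right, hx, real_inner_comm]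

variable {S : Type*} [MeasurableSpace S] {ρ : Measure S} [IsProbabilityMeasure ρ]

/-- The observation `h ⟪a, x⟫ ξ` is independent of the component of `a` orthogonal to `x`. The
integral over the noise is taken last, so that for fixed noise this is
`indepFun_inner_sub_inner_smul`. -/
lemma integral_mul_orthogonal_component {x : E} (hx : ‖x‖ = 1) {h : ℝ → S → ℝ}
    (hm : Measurable (Function.uncurry h)) {φ : E → ℝ} (hφ : Measurable φ)
    (h1 : Integrable (fun q : E × S => h ⟪q.1, x⟫ q.2) ((stdGaussian E).prod ρ))
    (h2 : Integrable (fun q : E × S => h ⟪q.1, x⟫ q.2 * φ (q.1 - ⟪q.1, x⟫ • x))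
      ((stdGaussian E).prod ρ)) :
    ∫ q, h ⟪q.1, x⟫ q.2 * φ (q.1 - ⟪q.1, x⟫ • x) ∂((stdGaussian E).prod ρ)
      = (∫ q, h ⟪q.1, x⟫ q.2 ∂((stdGaussian E).prod ρ)) *
        ∫ a, φ (a - ⟪a, x⟫ • x) ∂(stdGaussian E) := by
  rw [integral_prod_symm _ h2, integral_prod_symm _ h1, ← integral_mul_const]
  congr 1
  ext s
  have hms : Measurable (fun g => h g s) := hm.comp (measurable_id.prodMk measurable_const)
  have hind := (indepFun_inner_sub_inner_smul hx).comp hms hφ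
  refine hind.integral_fun_mul_eq_mul_integral ?_ ?_
  · exact (hms.comp (by fun_prop)).aestronglyMeasurable
  · exact (hφ.comp (by fun_prop)).aestronglyMeasurable

lemma integrable_mul_inner_mul_inner {F : E × S → ℝ} (hF : Measurable F)
    (hF2 : Integrable (fun q => F q ^ 2) ((stdGaussian E).prod ρ)) (u v : E) :
    Integrable (fun q => F q * (⟪q.1, u⟫ * ⟪q.1, v⟫)) ((stdGaussian E).prod ρ) := by
  have h4 : ∀ u : E, Integrable (fun q : E × S => ⟪q.1, u⟫ ^ 4) ((stdGaussian E).prod ρ) := by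
    intro u
    have h := (memLp_inner_stdGaussian u 4 (by simp)).integrable_norm_pow (by simp)
    have h' : Integrable (fun a : E => ⟪a, u⟫ ^ 4) (stdGaussian E) := by
      refine h.congr (Filter.Eventually.of_forall fun a => ?_)
      simp [Even.pow_abs (n := 4) (by decide)]
    exact h'.comp_fst ρ
  refine (hF2.add ((h4 u).add (h4 v))).mono' (hF.mul (by fun_prop)).aestronglyMeasurable ?_
  refine Filter.Eventually.of_forall fun q => ?_
  simp only [Pi.add_apply, Real.norm_eq_abs, abs_le]
  constructor <;> nlinarith [sq_nonneg (F q + ⟪q.1, u⟫ * ⟪q.1, v⟫), sq_nonneg (F q),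
    sq_nonneg (F q - ⟪q.1, u⟫ * ⟪q.1, v⟫), sq_nonneg (⟪q.1, u⟫ ^ 2 - ⟪q.1, v⟫ ^ 2),
    sq_nonneg (⟪q.1, u⟫ ^ 2), sq_nonneg (⟪q.1, v⟫ ^ 2)]

/-- The expected data matrix of a single index model is `Cov[y, (aᵀx)²] x xᵀ`: the component of `a`
orthogonal to `x` is independent of the observation and has identity covariance, so it
contributes nothing. -/
lemma integral_mul_quadratic_eq_covariance {x : E} (hx : ‖x‖ = 1) {f : ℝ → S → ℝ}
    (hf : Measurable (Function.uncurry f))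
    (hF2 : Integrable (fun q : E × S => f ⟪q.1, x⟫ q.2 ^ 2) ((stdGaussian E).prod ρ)) (u v : E) :
    ∫ q, f ⟪q.1, x⟫ q.2 * (⟪q.1, u⟫ * ⟪q.1, v⟫ - ⟪u, v⟫) ∂((stdGaussian E).prod ρ)
      = cov[fun q => f ⟪q.1, x⟫ q.2, fun q => ⟪q.1, x⟫ ^ 2; (stdGaussian E).prod ρ]
        * (⟪u, x⟫ * ⟪x, v⟫) := by
  set P := (stdGaussian E).prod ρ with hP
  have hFm : Measurable (fun q : E × S => f ⟪q.1, x⟫ q.2) :=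
    hf.comp ((by fun_prop : Measurable fun q : E × S => ⟪q.1, x⟫).prodMk measurable_snd)
  have hFL : MemLp (fun q : E × S => f ⟪q.1, x⟫ q.2) 2 P :=
    (memLp_two_iff_integrable_sq hFm.aestronglyMeasurable).2 hF2
  have hFi : Integrable (fun q : E × S => f ⟪q.1, x⟫ q.2) P := hFL.integrable (by simp)
  have hI := integrable_mul_inner_mul_inner hFm hF2
  have hI1 : ∀ u v : E, Integrable (fun a : E => ⟪a, u⟫ * ⟪a, v⟫) (stdGaussian E) := fun u v =>
    (memLp_inner_stdGaussian u 2 (by simp)).integrable_mul (memLp_inner_stdGaussian v 2 (by simp))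
  have hgL : MemLp (fun q : E × S => ⟪q.1, x⟫ ^ 2) 2 P := by
    refine (memLp_two_iff_integrable_sq (by fun_prop)).2 ?_
    have h := (memLp_inner_stdGaussian x 4 (by simp)).integrable_norm_pow (by simp)
    have h' : Integrable (fun a : E => (⟪a, x⟫ ^ 2) ^ 2) (stdGaussian E) := by
      refine h.congr (Filter.Eventually.of_forall fun a => ?_)
      simp only [Real.norm_eq_abs]
      rw [← pow_mul]
      exact Even.pow_abs (n := 4) (by decide) _
    exact h'.comp_fst ρ
  -- `b` is the component of `a` orthogonal to `x`
  have hb : ∀ (a w : E), ⟪a - ⟪a, x⟫ • x, w⟫ = ⟪a, w⟫ - ⟪a, x⟫ * ⟪x, w⟫ := fun a w => by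
    rw [inner_sub_left, real_inner_smul_left]
  have hxx : ⟪x, x⟫ = 1 := by simp [hx]
  set α := ⟪x, u⟫ with hα
  set β := ⟪x, v⟫ with hβ
  have j1 : Integrable (fun q : E × S => (f ⟪q.1, x⟫ q.2 * (⟪q.1, x⟫ * ⟪q.1, x⟫ - 1)) * (α * β))
      P := by
    refine (((hI x x).sub hFi).mul_const (α * β)).congr (Filter.Eventually.of_forall fun q => ?_)
    simp only [Pi.sub_apply]; ring
  have j2 : Integrable (fun q : E × S => (f ⟪q.1, x⟫ q.2 * ⟪q.1, x⟫) *
      (α * ⟪q.1 - ⟪q.1, x⟫ • x, v⟫ + β * ⟪q.1 - ⟪q.1, x⟫ • x, u⟫)) P := by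
    refine ((((hI x v).const_mul α).add ((hI x u).const_mul β)).sub
      ((hI x x).const_mul (2 * α * β))).congr (Filter.Eventually.of_forall fun q => ?_)
    simp only [Pi.add_apply, Pi.sub_apply, hb]
    ring
  have j3 : Integrable (fun q : E × S => f ⟪q.1, x⟫ q.2 *
      (⟪q.1 - ⟪q.1, x⟫ • x, u⟫ * ⟪q.1 - ⟪q.1, x⟫ • x, v⟫ - (⟪u, v⟫ - α * β))) P := by
    refine ((((hI u v).sub ((hI x v).const_mul α)).sub ((hI x u).const_mul β)).add
        (((hI x x).const_mul (α * β)).sub (hFi.mul_const (⟪u, v⟫ - α * β)))).congr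
        (Filter.Eventually.of_forall fun q => ?_)
    simp only [Pi.add_apply, Pi.sub_apply, hb]
    ring
  -- the cross term
  have hcross : ∫ q, (f ⟪q.1, x⟫ q.2 * ⟪q.1, x⟫) *
      (α * ⟪q.1 - ⟪q.1, x⟫ • x, v⟫ + β * ⟪q.1 - ⟪q.1, x⟫ • x, u⟫) ∂P = 0 := by
    rw [integral_mul_orthogonal_component (h := fun g s => f g s * g)
      (φ := fun b => α * ⟪b, v⟫ + β * ⟪b, u⟫) hx (hf.mul measurable_fst) (by fun_prop)]
    · have : ∫ a, (α * ⟪a - ⟪a, x⟫ • x, v⟫ + β * ⟪a - ⟪a, x⟫ • x, u⟫) ∂(stdGaussian E) = 0 := by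
        have e : ∀ a : E, α * ⟪a - ⟪a, x⟫ • x, v⟫ + β * ⟪a - ⟪a, x⟫ • x, u⟫
            = ⟪a, α • v + β • u - (2 * α * β) • x⟫ := by
          intro a
          rw [hb, hb, inner_sub_right, inner_add_right, real_inner_smul_right,
            real_inner_smul_right, real_inner_smul_right]
          ring
        simp_rw [e]
        exact integral_inner_stdGaussian _
      rw [this, mul_zero]
    · exact hFL.integrable_mul ((memLp_inner_stdGaussian x 2 (by simp)).comp_fst ρ)
    · exact j2
  -- the orthogonal term
  have hperp : ∫ q, f ⟪q.1, x⟫ q.2 * (⟪q.1 - ⟪q.1, x⟫ • x, u⟫ * ⟪q.1 - ⟪q.1, x⟫ • x, v⟫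
      - (⟪u, v⟫ - α * β)) ∂P = 0 := by
    rw [integral_mul_orthogonal_component (h := f)
      (φ := fun b => ⟪b, u⟫ * ⟪b, v⟫ - (⟪u, v⟫ - α * β)) hx hf (by fun_prop) hFi]
    · have : ∫ a, (⟪a - ⟪a, x⟫ • x, u⟫ * ⟪a - ⟪a, x⟫ • x, v⟫ - (⟪u, v⟫ - α * β))
          ∂(stdGaussian E) = 0 := by
        have e : ∀ a : E, ⟪a - ⟪a, x⟫ • x, u⟫ * ⟪a - ⟪a, x⟫ • x, v⟫
            = ⟪a, u - α • x⟫ * ⟪a, v - β • x⟫ := by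
          intro a
          rw [hb, hb, inner_sub_right, inner_sub_right, real_inner_smul_right,
            real_inner_smul_right]
          ring
        simp_rw [e]
        rw [integral_sub (hI1 _ _) (integrable_const _), integral_inner_mul_inner_stdGaussian]
        simp only [inner_sub_left, inner_sub_right, real_inner_smul_left, real_inner_smul_right,
          hxx, integral_const, probReal_univ, smul_eq_mul, one_mul]
        rw [real_inner_comm x u, ← hα, ← hβ]
        ring
      rw [this, mul_zero]
    · exact j3
  have hcov : cov[fun q => f ⟪q.1, x⟫ q.2, fun q => ⟪q.1, x⟫ ^ 2; P]
      = ∫ q, f ⟪q.1, x⟫ q.2 * (⟪q.1, x⟫ * ⟪q.1, x⟫ - 1) ∂P := by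
    rw [covariance_eq_sub hFL hgL]
    have h1 : ∫ q : E × S, ⟪q.1, x⟫ ^ 2 ∂P = 1 := by
      rw [hP, integral_fun_fst (fun a : E => ⟪a, x⟫ ^ 2)]
      simp_rw [pow_two]
      rw [integral_inner_mul_inner_stdGaussian, hxx]; simp
    rw [h1, mul_one]
    have e : ∀ q : E × S, f ⟪q.1, x⟫ q.2 * (⟪q.1, x⟫ * ⟪q.1, x⟫ - 1)
        = f ⟪q.1, x⟫ q.2 * (⟪q.1, x⟫ * ⟪q.1, x⟫) - f ⟪q.1, x⟫ q.2 := fun q => by ring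
    simp_rw [e]
    rw [integral_sub (hI x x) hFi]
    simp only [hP, pow_two, Pi.mul_apply]
  rw [hcov, real_inner_comm x u, ← hα]
  have e : ∀ q : E × S, f ⟪q.1, x⟫ q.2 * (⟪q.1, u⟫ * ⟪q.1, v⟫ - ⟪u, v⟫)
      = (f ⟪q.1, x⟫ q.2 * (⟪q.1, x⟫ * ⟪q.1, x⟫ - 1)) * (α * β)
        + (f ⟪q.1, x⟫ q.2 * ⟪q.1, x⟫) *
          (α * ⟪q.1 - ⟪q.1, x⟫ • x, v⟫ + β * ⟪q.1 - ⟪q.1, x⟫ • x, u⟫)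
        + f ⟪q.1, x⟫ q.2 * (⟪q.1 - ⟪q.1, x⟫ • x, u⟫ * ⟪q.1 - ⟪q.1, x⟫ • x, v⟫
          - (⟪u, v⟫ - α * β)) := by
    intro q
    rw [hb, hb]
    ring
  simp_rw [e]
  have j12 := j1.add j2
  rw [integral_add (by exact j12) j3, integral_add j1 j2, hcross, hperp, integral_mul_const]
  ring

end Gaussian

/-! ### Nets of Euclidean balls -/

section Net

lemma card_le_of_pairwise_lt_dist {k : ℕ} {r η : ℝ} (hr : 0 ≤ r) (hη : 0 < η)
    (s : Finset (EuclideanSpace ℝ (Fin k))) (hs : ∀ c ∈ s, ‖c‖ ≤ r)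
    (h : ∀ c ∈ s, ∀ d ∈ s, c ≠ d → η < dist c d) : (s.card : ℝ) ≤ (1 + 2 * r / η) ^ k := by
  let μ : Measure (EuclideanSpace ℝ (Fin k)) := volume
  have hη2 : 0 < η / 2 := by positivity
  have hR : 0 < r + η / 2 := by positivity
  have hd : (s : Set (EuclideanSpace ℝ (Fin k))).PairwiseDisjoint
      (fun c => Metric.ball c (η / 2)) := by
    intro c hc d hd hcd
    apply Metric.ball_disjoint_ball
    linarith [h c hc d hd hcd]
  have hsub : (⋃ c ∈ s, Metric.ball c (η / 2)) ⊆ Metric.ball 0 (r + η / 2) := by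
    refine Set.iUnion₂_subset fun c hc => Metric.ball_subset_ball' ?_
    rw [dist_zero_right]; linarith [hs c hc]
  have I : (s.card : ℝ≥0∞) * ENNReal.ofReal ((η / 2) ^ k) * μ (Metric.ball 0 1) ≤
      ENNReal.ofReal ((r + η / 2) ^ k) * μ (Metric.ball 0 1) := by
    have h1 := measure_mono (μ := μ) hsub
    rw [measure_biUnion_finset hd fun c _ => measurableSet_ball] at h1
    simp only [μ.addHaar_ball_of_pos _ hη2, μ.addHaar_ball_of_pos _ hR, Finset.sum_const,
      nsmul_eq_mul, finrank_euclideanSpace, Fintype.card_fin] at h1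
    rwa [← mul_assoc] at h1
  have J := (ENNReal.mul_le_mul_iff_left (Metric.measure_ball_pos μ _ zero_lt_one).ne'
    measure_ball_lt_top.ne).1 I
  have K := ENNReal.toReal_le_of_le_ofReal (by positivity) J
  rw [ENNReal.toReal_mul, ENNReal.toReal_natCast, ENNReal.toReal_ofReal (by positivity)] at K
  have e : 1 + 2 * r / η = (r + η / 2) / (η / 2) := by field_simp; ring
  rw [e, div_pow, le_div_iff₀ (by positivity)]
  exact K

/-- A net of the closed ball of radius `r` in `ℝᵏ` at scale `η`, with at most `(1 + 2 r / η) ^ k`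
points, by the volume argument. -/
lemma exists_finset_net_closedBall {k : ℕ} {r η : ℝ} (hr : 0 ≤ r) (hη : 0 < η) :
    ∃ Z : Finset (EuclideanSpace ℝ (Fin k)), (∀ z ∈ Z, z ∈ Metric.closedBall 0 r) ∧
      (∀ z ∈ Metric.closedBall (0 : EuclideanSpace ℝ (Fin k)) r, ∃ z' ∈ Z, dist z z' ≤ η) ∧
      (Z.card : ℝ) ≤ (1 + 2 * r / η) ^ k := by
  lift η to ℝ≥0 using hη.le
  set A := Metric.closedBall (0 : EuclideanSpace ℝ (Fin k)) r with hA
  have hfin : ∀ s : Finset (EuclideanSpace ℝ (Fin k)), (s : Set _) ⊆ A →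
      Metric.IsSeparated η (s : Set (EuclideanSpace ℝ (Fin k))) →
      (s.card : ℝ) ≤ (1 + 2 * r / η) ^ k := by
    intro s hsA hsep
    refine card_le_of_pairwise_lt_dist hr hη s (fun c hc => by simpa [hA] using hsA hc)
      fun c hc d hd hcd => ?_
    have : (η : ℝ≥0∞) < edist c d := hsep hc hd hcd
    rw [edist_dist] at this
    have h2 := (ENNReal.lt_ofReal_iff_toReal_lt (by simp)).1 this
    simpa using h2
  have hfinite : ∀ C : Set (EuclideanSpace ℝ (Fin k)), C ⊆ A → Metric.IsSeparated η C →
      C.encard ≤ (⌊(1 + 2 * r / η) ^ k⌋₊ : ℕ∞) := by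
    intro C hCA hsep
    by_contra! hlt
    obtain ⟨t, htC, ht⟩ := Set.exists_subset_encard_eq (Order.add_one_le_of_lt hlt)
    have htf : t.Finite := Set.finite_of_encard_eq_coe (k := ⌊(1 + 2 * r / η) ^ k⌋₊ + 1)
      (by rw [ht]; push_cast; rfl)
    have h1 := hfin htf.toFinset (by simpa using htC.trans hCA)
      (by simpa using hsep.subset htC)
    rw [htf.encard_eq_coe_toFinset_card] at ht
    have h2 : htf.toFinset.card = ⌊(1 + 2 * r / η) ^ k⌋₊ + 1 := by exact_mod_cast ht
    have h3 := Nat.le_floor h1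
    omega
  have hp : Metric.packingNumber η A ≠ ⊤ := by
    refine ne_top_of_le_ne_top (ENat.natCast_ne_top ⌊(1 + 2 * r / η) ^ k⌋₊) ?_
    exact iSup_le fun C => iSup_le fun h1 => iSup_le fun h2 => hfinite C h1 h2
  have hcov := Metric.isCover_maximalSeparatedSet hp
  have hF : (Metric.maximalSeparatedSet η A).Finite := by
    refine Set.finite_of_encard_le_coe (hfinite _ Metric.maximalSeparatedSet_subset
      Metric.isSeparated_maximalSeparatedSet)
  refine ⟨hF.toFinset, fun z hz => Metric.maximalSeparatedSet_subset (by simpa using hz),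
    fun z hz => ?_, hfin _ (by simpa using Metric.maximalSeparatedSet_subset)
      (by simpa using Metric.isSeparated_maximalSeparatedSet)⟩
  obtain ⟨z', hz', hd⟩ := hcov hz
  refine ⟨z', by simpa using hz', ?_⟩
  have hd' : edist z z' ≤ η := hd
  rw [edist_dist] at hd'
  simpa using ENNReal.toReal_le_of_le_ofReal (NNReal.coe_nonneg η)
    (by simpa using hd' : ENNReal.ofReal (dist z z') ≤ ENNReal.ofReal η)

end Net

/-! ### Sub-exponential observations and their truncation -/

section Subexponential

variable {E : Type*} [MeasurableSpace E] {P : Measure E} {Y : E → ℝ} {K : ℝ}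

lemma eLpNorm_le_of_subexpNorm_eq (h : subexpNorm Y P = ENNReal.ofReal K) {p : ℝ} (hp : 1 ≤ p) :
    eLpNorm Y (ENNReal.ofReal p) P ≤ ENNReal.ofReal (p * K) := by
  have h1 : (ENNReal.ofReal p)⁻¹ * eLpNorm Y (ENNReal.ofReal p) P ≤ ENNReal.ofReal K := by
    rw [← h]
    exact le_iSup₂ (f := fun (p : ℝ) (_ : 1 ≤ p) =>
      (ENNReal.ofReal p)⁻¹ * eLpNorm Y (ENNReal.ofReal p) P) p hp
  have hp0 : ENNReal.ofReal p ≠ 0 := by simp; linarith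
  rw [ENNReal.ofReal_mul (by linarith)]
  rwa [ENNReal.inv_mul_le_iff hp0 ENNReal.ofReal_ne_top] at h1

lemma hasFourthMoment_of_subexpNorm_eq (hY : Measurable Y) (hK : 0 < K)
    (h : subexpNorm Y P = ENNReal.ofReal K) : HasFourthMoment Y (4 * K) P := by
  have h4 := eLpNorm_le_of_subexpNorm_eq h (p := 4) (by norm_num)
  rw [show ENNReal.ofReal 4 = 4 by norm_num] at h4
  have hL : MemLp Y 4 P := ⟨hY.aestronglyMeasurable, h4.trans_lt ENNReal.ofReal_lt_top⟩
  have e : ∀ e, ‖Y e‖ ^ 4 = Y e ^ 4 := fun e => Even.pow_abs (by decide) _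
  have hint : Integrable (fun e => Y e ^ 4) P := by
    have := hL.integrable_norm_pow (p := 4) (by simp)
    simpa only [e] using this
  refine ⟨hY, hint, ?_⟩
  rw [hL.eLpNorm_eq_integral_rpow_norm (by simp) (by simp)] at h4
  have h5 := (ENNReal.ofReal_le_ofReal_iff (by positivity)).1 h4
  simp only [ENNReal.toReal_ofNat] at h5
  have e' : ∀ e, ‖Y e‖ ^ (4 : ℝ) = Y e ^ 4 := fun a => by rw [← e]; norm_cast
  simp only [e'] at h5
  have h0 : 0 ≤ ∫ e, Y e ^ 4 ∂P := integral_nonneg fun e => by positivity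
  have h6 := pow_le_pow_left₀ (by positivity) h5 4
  rwa [← Real.rpow_natCast (_ ^ _), ← Real.rpow_mul h0, show (4 : ℝ)⁻¹ * (4 : ℕ) = 1 by norm_num,
    Real.rpow_one] at h6

/-- The exponential tail of a sub-exponential variable, from Markov's inequality for its `p`-th
moment. -/
lemma measure_lt_abs_le_of_subexpNorm_eq (hY : Measurable Y) (hK : 0 < K)
    (h : subexpNorm Y P = ENNReal.ofReal K) {p : ℝ} (hp : 1 ≤ p) :
    P {e | 3 * p * K < |Y e|} ≤ ENNReal.ofReal (Real.exp (-p)) := by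
  have hp0 : 0 < p := by linarith
  have h1 := mul_meas_ge_le_pow_eLpNorm' P (p := ENNReal.ofReal p) (by simp; linarith)
    ENNReal.ofReal_ne_top hY.aestronglyMeasurable (ENNReal.ofReal (3 * (p * K)))
  rw [ENNReal.toReal_ofReal hp0.le] at h1
  have h2 : eLpNorm Y (ENNReal.ofReal p) P ^ p ≤ ENNReal.ofReal (p * K) ^ p :=
    ENNReal.rpow_le_rpow (eLpNorm_le_of_subexpNorm_eq h hp) hp0.le
  have h3 := h1.trans h2
  rw [ENNReal.ofReal_mul (by norm_num), ENNReal.mul_rpow_of_nonneg _ _ hp0.le, mul_comm,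
    ← mul_assoc] at h3
  have hne0 : ENNReal.ofReal (p * K) ^ p ≠ 0 := by
    rw [ENNReal.ofReal_rpow_of_pos (by positivity)]
    simp only [ne_eq, ENNReal.ofReal_eq_zero, not_le]
    positivity
  have hnetop : ENNReal.ofReal (p * K) ^ p ≠ ∞ := by
    rw [ENNReal.ofReal_rpow_of_pos (by positivity)]; simp
  have h4 := (ENNReal.mul_le_mul_iff_left hne0 hnetop).1 (h3.trans_eq (one_mul _).symm)
  have h5 : P {e | 3 * p * K < |Y e|} ≤ P {e | ENNReal.ofReal (3 * (p * K)) ≤ ‖Y e‖ₑ} := by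
    apply measure_mono
    intro e he
    simp only [Set.mem_ofPred_eq] at he ⊢
    rw [← ofReal_norm, Real.norm_eq_abs]
    exact ENNReal.ofReal_le_ofReal (by linarith)
  refine h5.trans ?_
  have h6 : ENNReal.ofReal (Real.exp p) ≤ ENNReal.ofReal 3 ^ p := by
    rw [ENNReal.ofReal_rpow_of_pos (by norm_num)]
    apply ENNReal.ofReal_le_ofReal
    rw [← Real.exp_one_rpow]
    gcongr
    linarith [Real.exp_one_lt_d9]
  have h7 : P {e | ENNReal.ofReal (3 * (p * K)) ≤ ‖Y e‖ₑ} * ENNReal.ofReal (Real.exp p) ≤ 1 := by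
    refine le_trans ?_ h4
    gcongr
    exact (ENNReal.ofReal_mul (by norm_num)).ge
  rw [Real.exp_neg, ENNReal.ofReal_inv_of_pos (Real.exp_pos p)]
  rwa [ENNReal.le_inv_iff_mul_le]

end Subexponential

section Sample

/-- `Y`, set to zero where it exceeds `B` in absolute value. -/
noncomputable def cutoff {E : Type*} (B : ℝ) (Y : E → ℝ) : E → ℝ := {e | |Y e| ≤ B}.indicator Y

lemma cutoff_of_le {E : Type*} {Y : E → ℝ} {B : ℝ} {e : E} (h : |Y e| ≤ B) : cutoff B Y e = Y e :=
  Set.indicator_of_mem (s := {e | |Y e| ≤ B}) h Y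

lemma cutoff_of_lt {E : Type*} {Y : E → ℝ} {B : ℝ} {e : E} (h : B < |Y e|) : cutoff B Y e = 0 :=
  Set.indicator_of_notMem (s := {e | |Y e| ≤ B}) (by simpa using h) Y

lemma abs_cutoff_le {E : Type*} {Y : E → ℝ} {B : ℝ} (hB : 0 ≤ B) (e : E) : |cutoff B Y e| ≤ B := by
  rcases le_or_gt |Y e| B with h | h
  · rwa [cutoff_of_le h]
  · rwa [cutoff_of_lt h, abs_zero]

variable {E : Type*} [MeasurableSpace E] {P : Measure E} {Y Q : E → ℝ} {D : ℝ}

lemma HasFourthMoment.indicator (hY : HasFourthMoment Y D P) {A : Set E} (hA : MeasurableSet A) :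
    HasFourthMoment (A.indicator Y) D P := by
  have e : ∀ a, A.indicator Y a ^ 4 = A.indicator (fun a => Y a ^ 4) a := by
    intro a
    by_cases ha : a ∈ A <;> simp [ha]
  refine ⟨hY.measurable.indicator hA, ?_, ?_⟩
  · simp_rw [e]; exact hY.integrable.indicator hA
  · refine le_trans (integral_mono ?_ hY.integrable fun a => ?_) hY.le_pow
    · simp_rw [e]; exact hY.integrable.indicator hA
    · rw [e]; exact Set.indicator_le_self' (fun _ _ => by positivity) a

lemma HasFourthMoment.cutoff (hY : HasFourthMoment Y D P) (B : ℝ) :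
    HasFourthMoment (cutoff B Y) D P :=
  hY.indicator (measurableSet_le hY.measurable.abs measurable_const)

lemma HasFourthMoment.abs (hY : HasFourthMoment Y D P) :
    HasFourthMoment (fun e => |Y e|) D P := by
  have e : ∀ a, |Y a| ^ 4 = Y a ^ 4 := fun a => Even.pow_abs (by decide) _
  exact ⟨hY.measurable.abs, by simpa only [e] using hY.integrable,
    by simpa only [e] using hY.le_pow⟩

variable [IsProbabilityMeasure P]

lemma integral_cutoff_mul_le (hD : 0 < D) (hY : HasFourthMoment Y D P)
    (hQ : HasExpMoment Q P) {B δ : ℝ} (hδ : 0 < δ) (hPB : P.real {e | B < |Y e|} ≤ δ ^ 2) :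
    ∫ e, cutoff B Y e * Q e ∂P ≤ ∫ e, Y e * Q e ∂P + 3100 * D * δ := by
  have hA : MeasurableSet {e | B < |Y e|} := measurableSet_lt measurable_const hY.measurable.abs
  have h1 := hY.integral_indicator_abs_mul_le hD hQ hA hδ hPB
  have h2 := integral_mono ((hY.cutoff B).integrable_mul hQ)
    ((hY.integrable_mul hQ).add ((hY.integrable_mul hQ).abs.indicator hA)) (fun e => by
      simp only [Pi.add_apply]
      rcases le_or_gt |Y e| B with he | he
      · rw [cutoff_of_le he, Set.indicator_of_notMem (by simpa using he), add_zero]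
      · rw [cutoff_of_lt he, Set.indicator_of_mem (by simpa using he)]
        linarith [neg_abs_le (Y e * Q e)])
  simp only [Pi.add_apply] at h2
  rw [integral_add (hY.integrable_mul hQ) ((hY.integrable_mul hQ).abs.indicator hA)] at h2
  linarith

variable {Ω : Type*} [MeasurableSpace Ω] {μ : Measure Ω} [IsProbabilityMeasure μ]
  {m : ℕ} {X : Fin m → Ω → E}

/-- Chernoff's bound for an average of independent copies of `Y Q`, with `Y` bounded by `B` and
`Q` sub-exponential. -/
lemma measure_sum_mul_ge_le (hX : ∀ i, HasLaw (X i) P μ) (hind : iIndepFun X μ) {B lam : ℝ}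
    (hD : 0 < D) (hB : ∀ e, |Y e| ≤ B) (hlam : 0 ≤ lam) (hlB : lam * B ≤ 1 / 16)
    (hY : HasFourthMoment Y D P) (hQ : HasExpMoment Q P) (t : ℝ) :
    μ {ω | m * (∫ e, Y e * Q e ∂P + t) ≤ ∑ i, Y (X i ω) * Q (X i ω)}
      ≤ ENNReal.ofReal (Real.exp (-(m * (lam * t - 100000 * lam ^ 2 * D ^ 2)))) := by
  have hm : Measurable (fun e => Y e * Q e) := hY.measurable.mul hQ.measurable
  set Z : Fin m → Ω → ℝ := fun i ω => Y (X i ω) * Q (X i ω) with hZ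
  have hZind : iIndepFun Z μ := hind.comp (fun _ e => Y e * Q e) fun _ => hm
  have hZm : ∀ i, AEMeasurable (Z i) μ := fun i => hm.comp_aemeasurable (hX i).aemeasurable
  have hmgf : ∀ i, mgf (Z i) μ lam = mgf (fun e => Y e * Q e) P lam := by
    intro i
    have := (hX i).integral_comp (f := fun e => Real.exp (lam * (Y e * Q e)))
      (hm.const_mul lam).exp.aestronglyMeasurable
    simpa [mgf, Function.comp_def] using this
  have hpos : 0 < mgf (fun e => Y e * Q e) P lam :=
    mgf_pos (hQ.integrable_exp_mul hB hlam hlB hY.measurable)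
  have hsum : mgf (∑ i, Z i) μ lam = mgf (fun e => Y e * Q e) P lam ^ m := by
    rw [hZind.mgf_sum₀ hZm]; simp [hmgf]
  have hint : Integrable (fun ω => Real.exp (lam * (∑ i, Z i) ω)) μ := by
    rw [← mgf_pos_iff, hsum]; positivity
  have h := measure_ge_le_exp_mul_mgf (X := ∑ i, Z i) (μ := μ) (m * (∫ e, Y e * Q e ∂P + t)) hlam
    hint
  rw [hsum] at h
  have h2 : mgf (fun e => Y e * Q e) P lam ^ m
      ≤ Real.exp (m * (lam * ∫ e, Y e * Q e ∂P + 100000 * lam ^ 2 * D ^ 2)) := by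
    rw [Real.exp_nat_mul]
    exact pow_le_pow_left₀ hpos.le (hY.mgf_mul_le hD hB hlam hlB hQ) m
  have h3 := h.trans (mul_le_mul_of_nonneg_left h2 (Real.exp_pos _).le)
  rw [← Real.exp_add] at h3
  rw [← ofReal_measureReal]
  apply ENNReal.ofReal_le_ofReal
  simp only [Finset.sum_apply] at h3
  refine h3.trans_eq ?_
  congr 1
  ring

end Sample

/-! ### One step of the projected power method -/

section Deterministic

lemma inner_toEuclideanLin_spectralMatrix {n m : ℕ} (a : Fin m → EuclideanSpace ℝ (Fin n))
    (y : Fin m → ℝ) (u v : EuclideanSpace ℝ (Fin n)) :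
    ⟪u, Matrix.toEuclideanLin (spectralMatrix a y) v⟫
      = 1 / (m : ℝ) * ∑ i, y i * (⟪a i, u⟫ * ⟪a i, v⟫ - ⟪u, v⟫) := by
  have h1 : ∀ b : EuclideanSpace ℝ (Fin n),
      ⟪u, Matrix.toEuclideanLin (Matrix.vecMulVec b.ofLp b.ofLp - 1) v⟫
        = ⟪b, u⟫ * ⟪b, v⟫ - ⟪u, v⟫ := by
    intro b
    have h2 : Matrix.toEuclideanLin (Matrix.vecMulVec b.ofLp b.ofLp - 1) v = ⟪b, v⟫ • b - v := by
      ext i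
      simp [Matrix.toLpLin_apply, Matrix.vecMulVec_mulVec,
        EuclideanSpace.inner_eq_star_dotProduct, dotProduct_comm]
    rw [h2, inner_sub_right, real_inner_smul_right, real_inner_comm b u]
    ring
  simp only [spectralMatrix, map_smul, map_sum, LinearMap.smul_apply, LinearMap.sum_apply,
    real_inner_smul_right, inner_sum, h1]

lemma abs_inner_toEuclideanLin_spectralMatrix_le {n m : ℕ}
    (a : Fin m → EuclideanSpace ℝ (Fin n)) (y : Fin m → ℝ) (u v : EuclideanSpace ℝ (Fin n)) :
    |⟪u, Matrix.toEuclideanLin (spectralMatrix a y) v⟫|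
      ≤ 1 / (m : ℝ) * (∑ i, |y i| * (‖a i‖ ^ 2 + 1)) * (‖u‖ * ‖v‖) := by
  rw [inner_toEuclideanLin_spectralMatrix, abs_mul, abs_of_nonneg (by positivity), mul_assoc]
  gcongr
  rw [Finset.sum_mul]
  refine (Finset.abs_sum_le_sum_abs _ _).trans (Finset.sum_le_sum fun i _ => ?_)
  rw [abs_mul, mul_assoc]
  gcongr
  have h1 := abs_real_inner_le_norm (a i) u
  have h2 := abs_real_inner_le_norm (a i) v
  have h3 := abs_real_inner_le_norm u v
  calc |⟪a i, u⟫ * ⟪a i, v⟫ - ⟪u, v⟫| ≤ |⟪a i, u⟫| * |⟪a i, v⟫| + |⟪u, v⟫| := by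
        rw [← abs_mul]; exact abs_sub _ _
    _ ≤ (‖a i‖ * ‖u‖) * (‖a i‖ * ‖v‖) + ‖u‖ * ‖v‖ := by gcongr
    _ = (‖a i‖ ^ 2 + 1) * (‖u‖ * ‖v‖) := by ring

variable {k n : ℕ} {G : EuclideanSpace ℝ (Fin k) → EuclideanSpace ℝ (Fin n)} {r : ℝ}
  {x : EuclideanSpace ℝ (Fin n)}

lemma IsRangeProj.inner_nonneg {s w : EuclideanSpace ℝ (Fin n)}
    (hG : ∀ z ∈ Metric.closedBall (0 : EuclideanSpace ℝ (Fin k)) r, ‖G z‖ = 1)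
    (hx : x ∈ G '' Metric.closedBall 0 r) (h : IsRangeProj G r s w) : 0 ≤ ⟪w - x, s⟫ := by
  obtain ⟨z, hz, hmin, rfl⟩ := h
  obtain ⟨z₀, hz₀, rfl⟩ := hx
  have h1 : ‖G z - s‖ ≤ ‖G z₀ - s‖ := hmin hz₀
  have h2 := pow_le_pow_left₀ (norm_nonneg _) h1 2
  rw [norm_sub_sq_real, norm_sub_sq_real, hG z hz, hG z₀ hz₀] at h2
  rw [inner_sub_left]
  linarith

lemma le_two_mul_of_sq_le {A d s : ℝ} (hA : 1 ≤ A) (hs : 0 < s) (hd : 0 ≤ d)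
    (h : d ^ 2 ≤ A * (s * d + s ^ 2)) : d ≤ 2 * A * s := by
  by_contra! hlt
  have h1 : s ≤ A * s := by nlinarith
  nlinarith [mul_pos hs hs, mul_nonneg hs.le hd]

/-- One step of the projected power method contracts to the error level `s`, for a matrix `V` that
acts like `ν x xᵀ` on the pairs of points of a `δ`-net of the range, up to a relative error of
order `Ky s`. The optimality of the projection gives `0 ≤ ⟪w' - x, V w⟫`, and on the sphere
`⟪w' - x, x⟫ = -‖w' - x‖² / 2`, so that `ν ⟪x, w⟫ ‖w' - x‖² / 2` is bounded by the error. -/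
lemma norm_sub_le_of_isRangeProj
    (V : EuclideanSpace ℝ (Fin n) →ₗ[ℝ] EuclideanSpace ℝ (Fin n)) {Ky ν c s δ T : ℝ}
    {W : Finset (EuclideanSpace ℝ (Fin n))} {w w' : EuclideanSpace ℝ (Fin n)}
    (hG : ∀ z ∈ Metric.closedBall (0 : EuclideanSpace ℝ (Fin k)) r, ‖G z‖ = 1)
    (hx : x ∈ G '' Metric.closedBall 0 r)
    (hW1 : ∀ u ∈ W, ‖u‖ = 1)
    (hW : ∀ u ∈ G '' Metric.closedBall 0 r, ∃ u' ∈ W, ‖u - u'‖ ≤ δ)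
    (hKy : 0 < Ky) (hν : 0 < ν) (hνK : ν ≤ 132 * Ky) (hc : 0 < c) (hc1 : c ≤ 1)
    (hs : 0 < s) (hs1 : s ≤ 1) (hδ : 0 ≤ δ) (hδs : δ ≤ s ^ 2) (hT : 0 ≤ T)
    (hTδ : T * δ ≤ 31000 * Ky * s ^ 2)
    (hVT : ∀ u v, |⟪u, V v⟫| ≤ T * (‖u‖ * ‖v‖))
    (hV : ∀ u ∈ W, ∀ v ∈ W,
      ⟪u - x, V v⟫ ≤ ν * (⟪u - x, x⟫ * ⟪x, v⟫) + 40000 * Ky * s * ‖u - x‖)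
    (hw : w ∈ G '' Metric.closedBall 0 r) (hcw : c ≤ ⟪x, w⟫) (hproj : IsRangeProj G r (V w) w') :
    ‖w' - x‖ ≤ 560000 * Ky / (ν * c) * s := by
  have hopt := hproj.inner_nonneg hG hx
  have hw' : w' ∈ G '' Metric.closedBall 0 r := by
    obtain ⟨z, hz, -, rfl⟩ := hproj
    exact ⟨z, hz, rfl⟩
  have hnorm : ∀ u ∈ G '' Metric.closedBall 0 r, ‖u‖ = 1 := by
    rintro _ ⟨z, hz, rfl⟩; exact hG z hz
  have hx1 := hnorm x hx
  have hw1 := hnorm w hw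
  have hw'1 := hnorm w' hw'
  obtain ⟨u, huW, hu⟩ := hW w' hw'
  obtain ⟨v, hvW, hv⟩ := hW w hw
  have hu1 := hW1 u huW
  have hv1 := hW1 v hvW
  set d := ‖w' - x‖ with hd
  have hd0 : 0 ≤ d := norm_nonneg _
  have hinner : ⟪w' - x, x⟫ = -(d ^ 2 / 2) := by
    rw [hd, norm_sub_sq_real, inner_sub_left, real_inner_self_eq_norm_sq, hx1, hw'1]
    ring
  have hd2 : d ≤ 2 := (norm_sub_le _ _).trans (by rw [hw'1, hx1]; norm_num)
  have hux : ‖u - x‖ ≤ d + δ := by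
    calc ‖u - x‖ = ‖(u - w') + (w' - x)‖ := by congr 1; abel
      _ ≤ ‖u - w'‖ + ‖w' - x‖ := norm_add_le _ _
      _ ≤ d + δ := by rw [norm_sub_rev u w']; linarith
  have hux2 : ‖u - x‖ ≤ 2 := (norm_sub_le _ _).trans (by rw [hu1, hx1]; norm_num)
  -- replace `w'` and `w` by the net points `u` and `v`
  have e1 : ⟪w' - x, V w⟫ = ⟪u - x, V v⟫ + ⟪w' - u, V w⟫ + ⟪u - x, V (w - v)⟫ := by
    simp only [map_sub, inner_sub_left, inner_sub_right]; ring
  have b1 : ⟪w' - u, V w⟫ ≤ T * δ := by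
    refine (le_abs_self _).trans ((hVT _ _).trans ?_)
    rw [hw1, mul_one]; gcongr
  have b2 : ⟪u - x, V (w - v)⟫ ≤ T * (2 * δ) := by
    refine (le_abs_self _).trans ((hVT _ _).trans ?_)
    gcongr
  have b3 := hV u huW v hvW
  have e2 : ⟪u - x, x⟫ * ⟪x, v⟫ = ⟪w' - x, x⟫ * ⟪x, w⟫ + ⟪u - w', x⟫ * ⟪x, v⟫
      + ⟪w' - x, x⟫ * ⟪x, v - w⟫ := by
    simp only [inner_sub_left, inner_sub_right]; ring
  have b4 : ⟪u - w', x⟫ * ⟪x, v⟫ ≤ δ * 1 := by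
    refine (le_abs_self _).trans ?_
    rw [abs_mul]
    have h1 := abs_real_inner_le_norm (u - w') x
    have h2 := abs_real_inner_le_norm x v
    rw [hx1, mul_one, norm_sub_rev] at h1
    rw [hx1, hv1, mul_one] at h2
    gcongr
    exact h1.trans hu
  have b5 : ⟪w' - x, x⟫ * ⟪x, v - w⟫ ≤ 2 * δ := by
    refine (le_abs_self _).trans ?_
    rw [abs_mul]
    have h1 := abs_real_inner_le_norm (w' - x) x
    have h2 := abs_real_inner_le_norm x (v - w)
    rw [hx1, mul_one] at h1
    rw [hx1, one_mul, norm_sub_rev] at h2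
    gcongr
    · exact h1.trans hd2
    · exact h2.trans hv
  have b6 : d ^ 2 / 2 * c ≤ d ^ 2 / 2 * ⟪x, w⟫ := by gcongr
  have b7 : 40000 * Ky * s * ‖u - x‖ ≤ 40000 * Ky * s * (d + s ^ 2) := by
    gcongr; linarith
  have b8 : ν * (⟪u - x, x⟫ * ⟪x, v⟫) ≤ ν * (3 * s ^ 2 - d ^ 2 / 2 * c) := by
    gcongr
    rw [e2, hinner] at *
    linarith
  have b9 : ν * s ^ 2 ≤ 132 * Ky * s ^ 2 := by gcongr
  have b10 : Ky * s * s ^ 2 ≤ Ky * 1 * s ^ 2 := by gcongr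
  have b11 : 0 ≤ Ky * s * d := by positivity
  have b12 : 0 ≤ Ky * s ^ 2 := by positivity
  have key : ν * c * d ^ 2 ≤ 280000 * Ky * (s * d + s ^ 2) := by nlinarith
  -- `ν ≤ 132 Ky` and `c ≤ 1` make the coefficient at least `1`, which absorbs the term `s ^ 2`
  have hA : 1 ≤ 280000 * Ky / (ν * c) := by
    rw [le_div_iff₀ (by positivity)]
    nlinarith
  have hfin := le_two_mul_of_sq_le hA hs hd0 (by
    rw [div_mul_eq_mul_div, le_div_iff₀ (by positivity)]
    linarith)
  refine hfin.trans_eq ?_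
  ring

end Deterministic

/-! ### Entropy against the Bernstein exponent -/

section Numerics

lemma two_thirds_le_log {t : ℝ} (ht : 2 ≤ t) : 2 / 3 ≤ Real.log t :=
  le_trans (by linarith [Real.log_two_gt_d9]) (Real.log_le_log (by norm_num) ht)

lemma log_sq_le {t : ℝ} (ht : 1 ≤ t) : Real.log t ^ 2 ≤ 2 * t := by
  have h := Real.pow_div_factorial_le_exp (x := Real.log t) (Real.log_nonneg ht) 2
  rw [Real.exp_log (by linarith)] at h
  norm_num [Nat.factorial] at h
  linarith

lemma log_pow_three_le {t : ℝ} (ht : 1 ≤ t) : Real.log t ^ 3 ≤ 6 * t := by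
  have h := Real.pow_div_factorial_le_exp (x := Real.log t) (Real.log_nonneg ht) 3
  rw [Real.exp_log (by linarith)] at h
  norm_num [Nat.factorial] at h
  linarith

/-- The entropy of the net of `(1 + 2 R / q) ^ k` points is dominated by the exponent that
Bernstein's inequality provides at the deviation `s = √q`. The logarithm of `1 / q` is at most of
order `log m` (used when the Gaussian regime `s` of the minimum is active), and `q log (1 / q)` is
at most of order `√q` (used in the exponential regime `1 / log m`). -/
lemma two_mul_entropy_add_log_le {k m : ℕ} {R q s : ℝ} (hk : 1 ≤ k) (hm : 2 ≤ m) (hR : 2 ≤ R)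
    (hq : q = k * Real.log R * Real.log m / m) (hq1 : q ≤ 1) (hs : 0 < s) (hsq : s ^ 2 = q) :
    2 * (k * Real.log (1 + 2 * R / q)) + Real.log m
      ≤ m * (20 * s * min s (1 / Real.log m)) := by
  have hm' : (2 : ℝ) ≤ m := by exact_mod_cast hm
  have hk' : (1 : ℝ) ≤ k := by exact_mod_cast hk
  set l := Real.log m with hl
  set H := Real.log R with hH
  have hl0 : 2 / 3 ≤ l := two_thirds_le_log hm'
  have hH0 : 2 / 3 ≤ H := two_thirds_le_log hR
  have hq0 : 0 < q := by rw [← hsq]; positivity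
  have hmq : m * q = k * H * l := by rw [hq]; field_simp
  have hs1 : s ≤ 1 := by nlinarith
  set lq := Real.log (1 / q) with hlq
  have hlq0 : 0 ≤ lq := Real.log_nonneg (by rw [le_div_iff₀ hq0]; linarith)
  have hent : Real.log (1 + 2 * R / q) ≤ 3 * H + lq := by
    have h1 : 1 + 2 * R / q ≤ R ^ 3 * (1 / q) := by
      have e : R ^ 3 * (1 / q) - (1 + 2 * R / q) = (R ^ 3 - 2 * R - q) / q := by field_simp; ring
      have : 0 ≤ (R ^ 3 - 2 * R - q) / q := by
        apply div_nonneg _ hq0.le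
        nlinarith [mul_nonneg (by linarith : (0 : ℝ) ≤ R - 2) (by positivity : 0 ≤ R ^ 2),
          mul_nonneg (by linarith : (0 : ℝ) ≤ R - 2) (by linarith : 0 ≤ R)]
      linarith
    refine (Real.log_le_log (by positivity) h1).trans_eq ?_
    rw [Real.log_mul (by positivity) (by positivity), Real.log_pow, Nat.cast_ofNat, hlq, hH]
  have hkH : 2 / 3 ≤ k * H := by nlinarith
  have hkHl : 2 / 3 * l ≤ k * H * l := by gcongr
  have hlq3 : lq ≤ 3 * l := by
    have h1 : 1 / q ≤ (m : ℝ) ^ 3 := by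
      rw [div_le_iff₀ hq0]
      have : (m : ℝ) ^ 3 * q = m ^ 2 * (m * q) := by ring
      rw [this, hmq]
      nlinarith
    refine (Real.log_le_log (by positivity) h1).trans_eq ?_
    rw [Real.log_pow, Nat.cast_ofNat, hl]
  have hkl : 0 ≤ k * l := by positivity
  have hLHS : 2 * (k * Real.log (1 + 2 * R / q)) + l ≤ 6 * (k * H) + 2 * (k * lq) + l := by
    have : k * Real.log (1 + 2 * R / q) ≤ k * (3 * H + lq) := by gcongr
    linarith
  have ha : 6 * (k * H) + 2 * (k * lq) + l ≤ m * (20 * s * s) := by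
    have e : (m : ℝ) * (20 * s * s) = 20 * (k * H * l) := by rw [← hmq, ← hsq]; ring
    rw [e]
    have h1 : k * H * (2 / 3) ≤ k * H * l := by gcongr
    have h2 : k * lq ≤ k * (3 * l) := by gcongr
    have h3 : k * l * (2 / 3) ≤ k * l * H := by gcongr
    nlinarith
  have hb : 6 * (k * H) + 2 * (k * lq) + l ≤ m * (20 * s * (1 / l)) := by
    have e : (m : ℝ) * (20 * s * (1 / l)) = 20 * (m * s) / l := by field_simp
    rw [e, le_div_iff₀ (by linarith)]
    have hslq : s * lq ≤ 2 := by
      have h1 : lq = 2 * Real.log (1 / s) := by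
        rw [hlq, ← hsq, one_div, one_div, Real.log_inv, Real.log_inv, Real.log_pow]
        push_cast; ring
      have h2 : Real.log (1 / s) ≤ 1 / s := (Real.log_le_sub_one_of_pos (by positivity)).trans
        (by linarith)
      calc s * lq = 2 * (s * Real.log (1 / s)) := by rw [h1]; ring
        _ ≤ 2 * (s * (1 / s)) := by gcongr
        _ = 2 := by field_simp
    have hms : 0 < m * s := by positivity
    have h1 : k * H * l ≤ m * s := by
      rw [← hmq, ← hsq]; nlinarith
    have h2 : k * lq * l ≤ 3 * (m * s) := by
      have h21 : k * l * (2 / 3) ≤ k * l * H := by gcongr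
      have h22 : k * l ≤ 3 / 2 * (m * s ^ 2) := by rw [hsq, hmq]; linarith
      calc k * lq * l = (k * l) * lq := by ring
        _ ≤ 3 / 2 * (m * s ^ 2) * lq := by gcongr
        _ = 3 / 2 * (m * s) * (s * lq) := by ring
        _ ≤ 3 / 2 * (m * s) * 2 := by gcongr
        _ = 3 * (m * s) := by ring
    have h3 : l * l ≤ 8 * (m * s) := by
      apply abs_le_of_sq_le_sq' _ (by positivity) |>.2
      have h31 : 2 / 3 * l ≤ m * s ^ 2 := by rw [hsq, hmq]; exact hkHl
      have h32 : l ^ 3 ≤ 6 * m := log_pow_three_le (by linarith)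
      have h33 : m * (2 / 3 * l) ≤ m * (m * s ^ 2) := by gcongr
      have h34 : l ^ 3 * l ≤ 6 * m * l := by gcongr
      nlinarith
    linarith
  refine hLHS.trans ?_
  rcases min_choice s (1 / l) with h | h <;> rw [h] <;> assumption

end Numerics

/-! ### The data matrix on a finite set of directions -/

section GoodEvent

lemma HasExpMoment.comp_fst {E S : Type*} [MeasurableSpace E] [MeasurableSpace S] {P : Measure E}
    [SFinite P] {Q : E → ℝ} (hQ : HasExpMoment Q P) (ρ : Measure S) [IsProbabilityMeasure ρ] :
    HasExpMoment (fun q : E × S => Q q.1) (P.prod ρ) := by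
  refine ⟨hQ.measurable.comp measurable_fst, hQ.integrable.comp_fst ρ, ?_⟩
  rw [integral_fun_fst (fun e => Real.exp (|Q e| / 4))]
  simpa using hQ.le_two

variable {n m : ℕ} {S : Type*} [MeasurableSpace S] {ρ : Measure S}
  {f : ℝ → S → ℝ} {x : EuclideanSpace ℝ (Fin n)} {Ky : ℝ}

instance [IsProbabilityMeasure ρ] : IsProbabilityMeasure (simLaw n ρ) := by unfold simLaw; infer_instance

lemma measurable_simObs (hf : Measurable (Function.uncurry f)) : Measurable (simObs f x) :=
  hf.comp ((by fun_prop : Measurable fun q : EuclideanSpace ℝ (Fin n) × S => ⟪q.1, x⟫).prodMk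
    measurable_snd)

lemma measure_lt_abs_simObs_le (hm : 2 ≤ m) (hf : Measurable (Function.uncurry f))
    (hKy : 0 < Ky) (hsub : subexpNorm (simObs f x) (simLaw n ρ) = ENNReal.ofReal Ky) :
    simLaw n ρ {q | 6 * Ky * Real.log m < |simObs f x q|}
      ≤ ENNReal.ofReal ((1 / (m : ℝ)) ^ 2) := by
  have hm' : (2 : ℝ) ≤ m := by exact_mod_cast hm
  have hl := two_thirds_le_log hm'
  have := measure_lt_abs_le_of_subexpNorm_eq (measurable_simObs hf) hKy hsub
    (p := 2 * Real.log m) (by linarith)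
  have e1 : 3 * (2 * Real.log m) * Ky = 6 * Ky * Real.log m := by ring
  have e2 : Real.exp (-(2 * Real.log m)) = (1 / (m : ℝ)) ^ 2 := by
    rw [Real.exp_neg, two_mul, Real.exp_add, Real.exp_log (by linarith), one_div, sq, mul_inv]
  rwa [e1, e2] at this

variable {Ω : Type*} [MeasurableSpace Ω] {μ : Measure Ω}
  {X : Fin m → Ω → EuclideanSpace ℝ (Fin n) × S}

lemma measure_exists_lt_abs_simObs_le (hm : 2 ≤ m) (hf : Measurable (Function.uncurry f))
    (hKy : 0 < Ky) (hsub : subexpNorm (simObs f x) (simLaw n ρ) = ENNReal.ofReal Ky)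
    (hX : ∀ i, HasLaw (X i) (simLaw n ρ) μ) :
    μ {ω | ∃ i, 6 * Ky * Real.log m < |simObs f x (X i ω)|} ≤ ENNReal.ofReal (1 / m) := by
  have hm' : (2 : ℝ) ≤ m := by exact_mod_cast hm
  have h1 : ∀ i, μ {ω | 6 * Ky * Real.log m < |simObs f x (X i ω)|}
      ≤ ENNReal.ofReal ((1 / (m : ℝ)) ^ 2) := by
    intro i
    rw [(hX i).measure_eq (p := fun q => 6 * Ky * Real.log m < |simObs f x q|)
      (measurableSet_lt measurable_const (measurable_simObs hf).abs)]
    exact measure_lt_abs_simObs_le hm hf hKy hsub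
  calc μ {ω | ∃ i, 6 * Ky * Real.log m < |simObs f x (X i ω)|}
      = μ (⋃ i, {ω | 6 * Ky * Real.log m < |simObs f x (X i ω)|}) := by
        congr 1; ext ω; simp
    _ ≤ ∑ i, μ {ω | 6 * Ky * Real.log m < |simObs f x (X i ω)|} := measure_iUnion_fintype_le _ _
    _ ≤ ∑ _i : Fin m, ENNReal.ofReal ((1 / (m : ℝ)) ^ 2) := Finset.sum_le_sum fun i _ => h1 i
    _ = ENNReal.ofReal (1 / m) := by
        rw [Finset.sum_const, Finset.card_univ, Fintype.card_fin, ← ENNReal.ofReal_nsmul]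
        congr 1
        rw [nsmul_eq_mul]
        field_simp

variable [IsProbabilityMeasure ρ]

lemma covariance_simObs_le (hx : ‖x‖ = 1) (hf : Measurable (Function.uncurry f)) (hKy : 0 < Ky)
    (hsub : subexpNorm (simObs f x) (simLaw n ρ) = ENNReal.ofReal Ky) :
    cov[simObs f x, fun q => ⟪q.1, x⟫ ^ 2; simLaw n ρ] ≤ 132 * Ky := by
  have hY := hasFourthMoment_of_subexpNorm_eq (measurable_simObs hf) hKy hsub
  have hQ := (hasExpMoment_inner_mul_inner_sub hx hx).comp_fst ρ
  have h1 := integral_mul_quadratic_eq_covariance hx hf (ρ := ρ) hY.integrable_sq x x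
  have hxx : ⟪x, x⟫ = 1 := by simp [hx]
  rw [hxx, mul_one, mul_one] at h1
  refine h1.symm.le.trans ?_
  have h2 := hY.integral_abs_mul_le (by positivity) hQ
  have h3 : ∫ q, simObs f x q * (⟪q.1, x⟫ * ⟪q.1, x⟫ - ⟪x, x⟫) ∂(simLaw n ρ)
      ≤ ∫ q, |simObs f x q * (⟪q.1, x⟫ * ⟪q.1, x⟫ - ⟪x, x⟫)| ∂(simLaw n ρ) :=
    integral_mono (hY.integrable_mul hQ) (hY.integrable_mul hQ).abs fun q => le_abs_self _
  rw [hxx] at h2 h3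
  exact h3.trans (h2.trans (by linarith))

variable [IsProbabilityMeasure μ]

/-- The deviation bound for the truncated observations in one sub-exponential direction `Q`. The
mean of the truncated product is at most `M`. -/
lemma measure_sum_cutoff_mul_ge_le (hm : 2 ≤ m) (hKy : 0 < Ky)
    (hX : ∀ i, HasLaw (X i) (simLaw n ρ) μ) (hind : iIndepFun X μ)
    {Y Q : EuclideanSpace ℝ (Fin n) × S → ℝ} (hY : HasFourthMoment Y (4 * Ky) (simLaw n ρ))
    (hQ : HasExpMoment Q (simLaw n ρ)) {M θ t : ℝ} (hθ : 0 ≤ θ) (hθl : θ ≤ 1 / Real.log m)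
    (hM : ∫ q, cutoff (6 * Ky * Real.log m) Y q * Q q ∂(simLaw n ρ) ≤ M) :
    μ {ω | m * (M + t * Ky) ≤ ∑ i, cutoff (6 * Ky * Real.log m) Y (X i ω) * Q (X i ω)}
      ≤ ENNReal.ofReal (Real.exp (-(m * (θ * t / 96 - 174 * θ ^ 2)))) := by
  have hm' : (2 : ℝ) ≤ m := by exact_mod_cast hm
  have hl := two_thirds_le_log hm'
  -- `6 Ky log m / (96 Ky) = log m / 16`, so `θ ≤ 1 / log m` keeps the parameter admissible
  have h := measure_sum_mul_ge_le hX hind (lam := θ / (96 * Ky)) (by positivity)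
    (abs_cutoff_le (by positivity)) (by positivity) (by
      have : θ * Real.log m ≤ 1 := by rwa [le_div_iff₀ (by linarith)] at hθl
      calc θ / (96 * Ky) * (6 * Ky * Real.log m) = θ * Real.log m / 16 := by field_simp; ring
        _ ≤ 1 / 16 := by gcongr) (hY.cutoff (6 * Ky * Real.log m)) hQ (t * Ky)
  refine (measure_mono fun ω hω => ?_).trans (h.trans (ENNReal.ofReal_le_ofReal ?_))
  · simp only [Set.mem_ofPred_eq] at hω ⊢
    refine le_trans ?_ hω
    gcongr
  · apply Real.exp_le_exp.2
    apply neg_le_neg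
    apply mul_le_mul_of_nonneg_left _ (by positivity)
    have e1 : θ / (96 * Ky) * (t * Ky) = θ * t / 96 := by field_simp
    have e2 : 100000 * (θ / (96 * Ky)) ^ 2 * (4 * Ky) ^ 2 = 1600000 / 9216 * θ ^ 2 := by
      field_simp; ring
    rw [e1, e2]
    nlinarith [sq_nonneg θ]

/-- The average that dominates the operator norm of the data matrix is of order `Ky n`. -/
lemma measure_sum_cutoff_mul_norm_sq_ge_le (hn : 1 ≤ n) (hm : 2 ≤ m) (hKy : 0 < Ky)
    (hX : ∀ i, HasLaw (X i) (simLaw n ρ) μ) (hind : iIndepFun X μ)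
    {Y : EuclideanSpace ℝ (Fin n) × S → ℝ} (hY : HasFourthMoment Y (4 * Ky) (simLaw n ρ)) :
    μ {ω | m * (132 * Ky + 30000 * Ky) ≤
        ∑ i, cutoff (6 * Ky * Real.log m) Y (X i ω) * ((‖(X i ω).1‖ ^ 2 + 1) / n)}
      ≤ ENNReal.ofReal (1 / m) := by
  have hm' : (2 : ℝ) ≤ m := by exact_mod_cast hm
  have hl := two_thirds_le_log hm'
  have hQ := (hasExpMoment_norm_sq hn).comp_fst ρ
  have h := measure_sum_cutoff_mul_ge_le (M := 132 * Ky) (θ := 1 / Real.log m) (t := 30000)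
    hm hKy hX hind hY hQ (by positivity) le_rfl (by
      have hi := (hY.cutoff (6 * Ky * Real.log m)).integrable_mul hQ
      refine (integral_mono hi hi.abs fun q => le_abs_self _).trans ?_
      refine ((hY.cutoff _).integral_abs_mul_le (by positivity) hQ).trans ?_
      linarith)
  refine h.trans (ENNReal.ofReal_le_ofReal ?_)
  set l := Real.log m with hl'
  have e0 : (1 : ℝ) / m = Real.exp (-l) := by
    rw [Real.exp_neg, hl', Real.exp_log (by linarith), one_div]
  rw [e0]
  apply Real.exp_le_exp.2
  apply neg_le_neg
  have h2 : l ^ 2 ≤ 2 * m := log_sq_le (by linarith)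
  have e : m * (1 / l * 30000 / 96 - 174 * (1 / l) ^ 2) - l
      = (m * (312.5 * l - 174) - l ^ 2 * l) / l ^ 2 := by
    field_simp; ring
  have : 0 ≤ (m * (312.5 * l - 174) - l ^ 2 * l) / l ^ 2 := by
    apply div_nonneg _ (by positivity)
    have h3 : l ^ 2 * l ≤ 2 * m * l := by gcongr
    nlinarith
  linarith

/-- The upper tail of the bilinear form of the data matrix in two unit vectors `u` and `v`. The term
of order `1 / m` is the bias of the truncation, and the parameter `min s (1 / log m)` of Chernoff's
bound covers both the Gaussian and the exponential regime. -/
lemma measure_sum_cutoff_mul_inner_ge_le {s : ℝ} (hm : 2 ≤ m) (hx : ‖x‖ = 1)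
    (hf : Measurable (Function.uncurry f)) (hKy : 0 < Ky)
    (hsub : subexpNorm (simObs f x) (simLaw n ρ) = ENNReal.ofReal Ky)
    (hX : ∀ i, HasLaw (X i) (simLaw n ρ) μ) (hind : iIndepFun X μ) (hs : 0 < s)
    {u v : EuclideanSpace ℝ (Fin n)} (hu : ‖u‖ = 1) (hv : ‖v‖ = 1) :
    μ {ω | m * (cov[simObs f x, fun q => ⟪q.1, x⟫ ^ 2; simLaw n ρ] * (⟪u, x⟫ * ⟪x, v⟫)
          + 3100 * (4 * Ky) * (1 / m) + 20000 * s * Ky) ≤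
        ∑ i, cutoff (6 * Ky * Real.log m) (simObs f x) (X i ω)
          * (⟪(X i ω).1, u⟫ * ⟪(X i ω).1, v⟫ - ⟪u, v⟫)}
      ≤ ENNReal.ofReal (Real.exp (-(m * (20 * s * min s (1 / Real.log m))))) := by
  have hm' : (2 : ℝ) ≤ m := by exact_mod_cast hm
  have hl := two_thirds_le_log hm'
  have hY := hasFourthMoment_of_subexpNorm_eq (measurable_simObs hf) hKy hsub
  have hQ := (hasExpMoment_inner_mul_inner_sub hu hv).comp_fst ρ
  have hmin : 0 ≤ min s (1 / Real.log m) := le_min hs.le (by positivity)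
  have hmean := integral_mul_quadratic_eq_covariance hx hf (ρ := ρ) hY.integrable_sq u v
  have hPB := ENNReal.toReal_le_of_le_ofReal (by positivity)
    (measure_lt_abs_simObs_le hm hf hKy hsub)
  have hcut := integral_cutoff_mul_le (by positivity) hY hQ (δ := 1 / (m : ℝ)) (by positivity) hPB
  have hM := hcut.trans_eq (congrArg (· + 3100 * (4 * Ky) * (1 / (m : ℝ))) hmean)
  refine (measure_sum_cutoff_mul_ge_le (θ := min s (1 / Real.log m)) (t := 20000 * s) hm hKy hX
    hind hY hQ hmin (min_le_right _ _) hM).trans (ENNReal.ofReal_le_ofReal ?_)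
  apply Real.exp_le_exp.2
  apply neg_le_neg
  apply mul_le_mul_of_nonneg_left _ (by positivity)
  have h1 : min s (1 / Real.log m) ^ 2 ≤ s * min s (1 / Real.log m) := by
    rw [sq]; exact mul_le_mul_of_nonneg_right (min_le_left _ _) hmin
  nlinarith [mul_nonneg hs.le hmin]

lemma abs_inner_toEuclideanLin_spectralMatrix_le_of_sum_lt (hn : 1 ≤ n) (hm : 1 ≤ m)
    (hKy : 0 < Ky) {a : Fin m → EuclideanSpace ℝ (Fin n)} {y : Fin m → ℝ}
    (h : ∑ i, |y i| * ((‖a i‖ ^ 2 + 1) / n) < m * (132 * Ky + 30000 * Ky))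
    (u v : EuclideanSpace ℝ (Fin n)) :
    |⟪u, Matrix.toEuclideanLin (spectralMatrix a y) v⟫| ≤ 31000 * Ky * n * (‖u‖ * ‖v‖) := by
  have hm0 : (0 : ℝ) < m := by exact_mod_cast hm
  have hn0 : (0 : ℝ) < n := by exact_mod_cast hn
  refine (abs_inner_toEuclideanLin_spectralMatrix_le _ _ u v).trans ?_
  refine mul_le_mul_of_nonneg_right ?_ (by positivity)
  simp_rw [← mul_div_assoc] at h
  rw [← Finset.sum_div, div_lt_iff₀ hn0] at h
  rw [one_div, inv_mul_le_iff₀ hm0]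
  have : 0 ≤ m * (Ky * n) := by positivity
  nlinarith

/-- Rescaling a bound in the unit direction of `u - x` to a bound relative to `‖u - x‖`. -/
lemma inner_sub_toEuclideanLin_spectralMatrix_le {ν s : ℝ} (hm : 1 ≤ m) (hKy : 0 < Ky)
    (hs : 0 < s) (hms : 2 / 3 / m ≤ s) {a : Fin m → EuclideanSpace ℝ (Fin n)} {y : Fin m → ℝ}
    {u v : EuclideanSpace ℝ (Fin n)} (hux : u ≠ x)
    (h : ∑ i, y i * (⟪a i, ‖u - x‖⁻¹ • (u - x)⟫ * ⟪a i, v⟫ - ⟪‖u - x‖⁻¹ • (u - x), v⟫)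
      < m * (ν * (⟪‖u - x‖⁻¹ • (u - x), x⟫ * ⟪x, v⟫) + 3100 * (4 * Ky) * (1 / m)
        + 20000 * s * Ky)) :
    ⟪u - x, Matrix.toEuclideanLin (spectralMatrix a y) v⟫
      ≤ ν * (⟪u - x, x⟫ * ⟪x, v⟫) + 40000 * Ky * s * ‖u - x‖ := by
  have hm0 : (0 : ℝ) < m := by exact_mod_cast hm
  set p := ‖u - x‖⁻¹ • (u - x) with hp
  have hne : ‖u - x‖ ≠ 0 := norm_ne_zero_iff.2 (sub_ne_zero.2 hux)
  have hup : u - x = ‖u - x‖ • p := by rw [hp, smul_smul, mul_inv_cancel₀ hne, one_smul]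
  have h3 : ⟪p, Matrix.toEuclideanLin (spectralMatrix a y) v⟫
      ≤ ν * (⟪p, x⟫ * ⟪x, v⟫) + 40000 * Ky * s := by
    rw [inner_toEuclideanLin_spectralMatrix, one_div, inv_mul_le_iff₀ hm0]
    refine h.le.trans ?_
    rw [add_assoc]
    gcongr
    have h1 : 1 / (m : ℝ) ≤ 3 / 2 * s := by
      have e : 1 / (m : ℝ) = 3 / 2 * (2 / 3 / m) := by field_simp
      rw [e]; gcongr
    have h4 : 3100 * (4 * Ky) * (1 / m) ≤ 3100 * (4 * Ky) * (3 / 2 * s) := by gcongr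
    nlinarith [mul_pos hKy hs]
  have h5 := mul_le_mul_of_nonneg_left h3 (norm_nonneg (u - x))
  have e1 : ∀ z, ⟪u - x, z⟫ = ‖u - x‖ * ⟪p, z⟫ := fun z => by
    rw [← real_inner_smul_left, ← hup]
  rw [e1, e1]
  linarith

/-- With probability at least `1 - 3 / m` the data matrix `V` has operator norm at most of order
`Ky n`, and acts like its expectation `ν x xᵀ` on all pairs of points of a finite set `W` of unit
vectors, up to a relative error of order `Ky s`, provided that the entropy of `W` allows for it. -/
lemma measure_not_approx_le {ν s : ℝ} (hn : 1 ≤ n) (hm : 2 ≤ m) (hx : ‖x‖ = 1)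
    (hf : Measurable (Function.uncurry f)) (hKy : 0 < Ky)
    (hsub : subexpNorm (simObs f x) (simLaw n ρ) = ENNReal.ofReal Ky)
    (hcov : cov[simObs f x, fun q => ⟪q.1, x⟫ ^ 2; simLaw n ρ] = ν)
    (hX : ∀ i, HasLaw (X i) (simLaw n ρ) μ) (hind : iIndepFun X μ)
    (W : Finset (EuclideanSpace ℝ (Fin n))) (hW : ∀ w ∈ W, ‖w‖ = 1) (hs : 0 < s)
    (hms : 2 / 3 / m ≤ s)
    (hent : (W.card : ℝ) ^ 2 * m ≤ Real.exp (m * (20 * s * min s (1 / Real.log m)))) :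
    μ {ω | ¬ ((∀ u v, |⟪u, Matrix.toEuclideanLin (spectralMatrix (fun i => (X i ω).1)
            (fun i => simObs f x (X i ω))) v⟫| ≤ 31000 * Ky * n * (‖u‖ * ‖v‖)) ∧
        ∀ u ∈ W, ∀ v ∈ W, ⟪u - x, Matrix.toEuclideanLin (spectralMatrix (fun i => (X i ω).1)
            (fun i => simObs f x (X i ω))) v⟫
          ≤ ν * (⟪u - x, x⟫ * ⟪x, v⟫) + 40000 * Ky * s * ‖u - x‖)}
      ≤ ENNReal.ofReal (3 / m) := by
  have hm' : (2 : ℝ) ≤ m := by exact_mod_cast hm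
  have hm0 : (0 : ℝ) < m := by linarith
  set F := simObs f x with hF
  have hY : HasFourthMoment F (4 * Ky) (simLaw n ρ) :=
    hasFourthMoment_of_subexpNorm_eq (measurable_simObs hf) hKy hsub
  set B := 6 * Ky * Real.log m with hB
  -- the unit direction from `x` to a net point
  let p : EuclideanSpace ℝ (Fin n) → EuclideanSpace ℝ (Fin n) := fun u => ‖u - x‖⁻¹ • (u - x)
  have hp1 : ∀ u, u ≠ x → ‖p u‖ = 1 := fun u hu => norm_smul_inv_norm (sub_ne_zero.2 hu)
  let Bad : EuclideanSpace ℝ (Fin n) × EuclideanSpace ℝ (Fin n) → Set Ω := fun uv =>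
    {ω | m * (ν * (⟪p uv.1, x⟫ * ⟪x, uv.2⟫) + 3100 * (4 * Ky) * (1 / m) + 20000 * s * Ky) ≤
      ∑ i, cutoff B F (X i ω) * (⟪(X i ω).1, p uv.1⟫ * ⟪(X i ω).1, uv.2⟫ - ⟪p uv.1, uv.2⟫)}
  have hM1 := measure_exists_lt_abs_simObs_le hm hf hKy hsub hX
  have hM2 := measure_sum_cutoff_mul_norm_sq_ge_le hn hm hKy hX hind hY.abs
  have hM3 : ∀ uv ∈ (W ×ˢ W).filter (fun uv => uv.1 ≠ x), μ (Bad uv) ≤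
      ENNReal.ofReal (Real.exp (-(m * (20 * s * min s (1 / Real.log m))))) := by
    rintro ⟨u, v⟩ huv
    simp only [Finset.mem_filter, Finset.mem_product] at huv
    have h := measure_sum_cutoff_mul_inner_ge_le hm hx hf hKy hsub hX hind hs (hp1 u huv.2)
      (hW v huv.1.2)
    rwa [hcov] at h
  have hM3' : μ (⋃ uv ∈ (W ×ˢ W).filter (fun uv => uv.1 ≠ x), Bad uv)
      ≤ ENNReal.ofReal (1 / m) := by
    refine (measure_biUnion_finset_le _ _).trans ((Finset.sum_le_sum hM3).trans ?_)
    rw [Finset.sum_const, ← ENNReal.ofReal_nsmul, nsmul_eq_mul]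
    apply ENNReal.ofReal_le_ofReal
    have hcard : ((((W ×ˢ W).filter (fun uv => uv.1 ≠ x)).card : ℕ) : ℝ) ≤ (W.card : ℝ) ^ 2 := by
      rw [sq, ← Nat.cast_mul, ← Finset.card_product]
      exact_mod_cast Finset.card_filter_le _ _
    rw [Real.exp_neg, ← div_eq_mul_inv, div_le_div_iff₀ (Real.exp_pos _) hm0, one_mul]
    exact (mul_le_mul_of_nonneg_right hcard hm0.le).trans hent
  have hthree : ENNReal.ofReal (1 / m) + ENNReal.ofReal (1 / m) + ENNReal.ofReal (1 / m)
      = ENNReal.ofReal (3 / m) := by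
    rw [← ENNReal.ofReal_add (by positivity) (by positivity),
      ← ENNReal.ofReal_add (by positivity) (by positivity)]
    congr 1
    ring
  rw [← hthree]
  refine le_trans ?_ (add_le_add (add_le_add hM1 hM2) hM3')
  refine le_trans (measure_mono ?_) ((measure_union_le _ _).trans
    (add_le_add (measure_union_le _ _) le_rfl))
  intro ω hω
  by_contra hgood
  apply hω
  simp only [Set.mem_union, not_or, Set.mem_iUnion, not_exists] at hgood
  obtain ⟨⟨hg1, hg2⟩, hg3⟩ := hgood
  have hg1' : ∀ i, |F (X i ω)| ≤ B := by
    intro i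
    by_contra! hlt
    exact hg1 ⟨i, hlt⟩
  constructor
  · refine abs_inner_toEuclideanLin_spectralMatrix_le_of_sum_lt hn (by omega) hKy ?_
    have h1 := hg2
    simp only [Set.mem_ofPred_eq, not_le] at h1
    refine lt_of_eq_of_lt (Finset.sum_congr rfl fun i _ => ?_) h1
    rw [cutoff_of_le (by simpa using hg1' i)]
  · intro u hu v hv
    by_cases hux : u = x
    · simp [hux]
    refine inner_sub_toEuclideanLin_spectralMatrix_le (by omega) hKy hs hms hux ?_
    have h1 := hg3 (u, v) (by simp [hu, hv, hux])
    simp only [Bad, Set.mem_ofPred_eq, not_le] at h1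
    refine lt_of_eq_of_lt (Finset.sum_congr rfl fun i _ => ?_) h1
    rw [cutoff_of_le (hg1' i)]

end GoodEvent

/-! ### Convergence of the projected power method -/

/-- A net of the range of a Lipschitz map on a ball, at scale `q / n`, with cardinality controlled
by the parameter `n L r`. -/
lemma exists_finset_net_range {n k : ℕ} {L : ℝ≥0} {r q : ℝ}
    {G : EuclideanSpace ℝ (Fin k) → EuclideanSpace ℝ (Fin n)}
    (hG : LipschitzOnWith L G (Metric.closedBall 0 r)) (hn : 0 < n) (hL : 0 < L) (hr : 0 ≤ r)
    (hq : 0 < q) :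
    ∃ W : Finset (EuclideanSpace ℝ (Fin n)), (∀ u ∈ W, u ∈ G '' Metric.closedBall 0 r) ∧
      (∀ u ∈ G '' Metric.closedBall 0 r, ∃ u' ∈ W, ‖u - u'‖ ≤ q / n) ∧
      (W.card : ℝ) ≤ (1 + 2 * (n * L * r) / q) ^ k := by
  classical
  have hn' : (0 : ℝ) < n := by exact_mod_cast hn
  have hL' : (0 : ℝ) < L := by exact_mod_cast hL
  obtain ⟨Z, hZ, hnet, hcard⟩ := exists_finset_net_closedBall (k := k) hr
    (η := q / (n * L)) (by positivity)
  refine ⟨Z.image G, fun u hu => ?_, ?_, ?_⟩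
  · obtain ⟨z, hz, rfl⟩ := Finset.mem_image.1 hu
    exact ⟨z, hZ z hz, rfl⟩
  · rintro _ ⟨z, hz, rfl⟩
    obtain ⟨z', hz', hd⟩ := hnet z hz
    refine ⟨G z', Finset.mem_image_of_mem G hz', ?_⟩
    rw [← dist_eq_norm]
    calc dist (G z) (G z') ≤ L * dist z z' := hG.dist_le_mul z hz z' (hZ z' hz')
      _ ≤ L * (q / (n * L)) := by gcongr
      _ = q / n := by field_simp
  · have h1 : ((Z.image G).card : ℝ) ≤ Z.card := by exact_mod_cast Finset.card_image_le
    refine h1.trans (hcard.trans_eq ?_)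
    congr 2
    field_simp

lemma IsProjPowerSeq.mem_range {k n : ℕ} {r : ℝ}
    {G : EuclideanSpace ℝ (Fin k) → EuclideanSpace ℝ (Fin n)} {V : Matrix (Fin n) (Fin n) ℝ}
    {w : ℕ → EuclideanSpace ℝ (Fin n)} (hw : IsProjPowerSeq G r V w) {t : ℕ} (ht : 1 ≤ t) :
    w t ∈ G '' Metric.closedBall 0 r := by
  obtain ⟨t, rfl⟩ := Nat.exists_eq_add_of_le' ht
  obtain ⟨z, hz, -, h⟩ := hw t
  exact ⟨z, hz, h.symm⟩

theorem theorem1 :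
    ∃ C : ℝ, 0 < C ∧ ∀ Ky ν c₀ : ℝ, 0 < Ky → 0 < ν → 0 < c₀ →
    ∃ C₁ : ℝ, 0 < C₁ ∧
    ∀ (n k m : ℕ) (L : ℝ≥0) (r : ℝ)
      (G : EuclideanSpace ℝ (Fin k) → EuclideanSpace ℝ (Fin n))
      (x : EuclideanSpace ℝ (Fin n))
      (S : Type*) [MeasurableSpace S] (ρ : Measure S) [IsProbabilityMeasure ρ]
      (f : ℝ → S → ℝ)
      (Ω : Type*) [MeasurableSpace Ω] (μ : Measure Ω) [IsProbabilityMeasure μ]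
      (a : Fin m → Ω → EuclideanSpace ℝ (Fin n)) (ξ : Fin m → Ω → S),
      -- the generative model, with normalized range containing the signal
      LipschitzOnWith L G (Metric.closedBall 0 r) →
      (∀ z ∈ Metric.closedBall (0 : EuclideanSpace ℝ (Fin k)) r, ‖G z‖ = 1) →
      x ∈ G '' Metric.closedBall 0 r →
      2 ≤ (n : ℝ) * L * r →
      -- the link: `y` is sub-exponential with norm `Ky`, and `Cov[y, (aᵀx)²] = ν`
      Measurable (Function.uncurry f) →
      subexpNorm (simObs f x) (simLaw n ρ) = ENNReal.ofReal Ky →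
      covariance (simObs f x) (fun q => ⟪q.1, x⟫ ^ 2) (simLaw n ρ) = ν →
      -- the samples are i.i.d.
      (∀ i, HasLaw (fun ω => (a i ω, ξ i ω)) (simLaw n ρ) μ) →
      iIndepFun (fun i ω => (a i ω, ξ i ω)) μ →
      -- the sample size
      1 ≤ m →
      C₁ * ((k * Real.log (n * L * r)) * Real.log m) ≤ m →
      -- the failure event has probability `O(1/m)`
      μ {ω | ¬ ∀ w : ℕ → EuclideanSpace ℝ (Fin n),
          IsProjPowerSeq G r
            (spectralMatrix (fun i => a i ω) (fun i => simObs f x (a i ω, ξ i ω))) w →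
          ∀ t₀ : ℕ, 1 ≤ t₀ → c₀ ≤ ⟪x, w t₀⟫ →
          ∀ t : ℕ, t₀ < t →
            ‖w t - x‖ ≤ C * Ky / (ν * c₀) *
              Real.sqrt ((k * Real.log (n * L * r)) * Real.log m / m)}
        ≤ ENNReal.ofReal (C / m) := by
  -- twice the constant of `norm_sub_le_of_isRangeProj`, which is used with correlation `c₀ / 2`
  refine ⟨1120000, by norm_num, fun Ky ν c₀ hKy hν hc₀ => ?_⟩
  set A : ℝ := 1120000 * Ky / (ν * c₀) with hA
  have hA0 : 0 < A := by positivity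
  -- the sample size ensures `q ≤ 1` and `A √q ≤ 1`
  refine ⟨max 1 (A ^ 2), by positivity, ?_⟩
  intro n k m L r G x S _ ρ _ f Ω _ μ _ a ξ hLip hG hx hR hf hsub hcov hlaw hind hm hsize
  have hm0 : (1 : ℝ) ≤ m := by exact_mod_cast hm
  -- a single sample: the probability bound is void
  rcases Nat.lt_or_ge m 2 with hm2 | hm2
  · have hm1 : m = 1 := by omega
    refine prob_le_one.trans ?_
    rw [ENNReal.one_le_ofReal, hm1]
    norm_num
  have hm2' : (2 : ℝ) ≤ m := by exact_mod_cast hm2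
  have hx1 : ‖x‖ = 1 := by obtain ⟨z, hz, rfl⟩ := hx; exact hG z hz
  have hn : 0 < n := by
    rcases Nat.eq_zero_or_pos n with h | h
    · subst h; norm_num at hR
    · exact h
  have hL : 0 < L := by
    rcases eq_or_lt_of_le (zero_le (a := L)) with h | h
    · rw [← h] at hR; norm_num at hR
    · exact h
  have hn' : (1 : ℝ) ≤ n := by exact_mod_cast hn
  have hr : 0 ≤ r := by
    by_contra! h
    have : (n : ℝ) * L * r ≤ 0 := mul_nonpos_of_nonneg_of_nonpos (by positivity) h.le
    linarith
  -- zero latent dimension: the range is the single point `x`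
  rcases Nat.eq_zero_or_pos k with hk | hk
  · subst hk
    refine (measure_mono_null (t := ∅) (fun ω hω => ?_) measure_empty).trans_le zero_le
    simp only [Set.mem_ofPred_eq] at hω
    refine (hω ?_).elim
    intro w hw t₀ ht₀ _ t ht
    obtain ⟨z, _, hz⟩ := hw.mem_range (t := t) (by omega)
    obtain ⟨z', _, hz'⟩ := hx
    rw [← hz, ← hz', Subsingleton.elim z z', sub_self, norm_zero]
    positivity
  set R : ℝ := n * L * r with hRdef
  set q : ℝ := k * Real.log R * Real.log m / m with hq
  have hl := two_thirds_le_log hm2'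
  have hH := two_thirds_le_log hR
  have hk' : (1 : ℝ) ≤ k := by exact_mod_cast hk
  have hq0 : 0 < q := by positivity
  have hsize1 : k * Real.log R * Real.log m ≤ m := by
    refine le_trans ?_ hsize
    exact le_mul_of_one_le_left (by positivity) (le_max_left _ _)
  have hq1 : q ≤ 1 := by rw [hq, div_le_one (by linarith)]; exact hsize1
  have hAq : A ^ 2 * q ≤ 1 := by
    rw [hq, ← mul_div_assoc, div_le_one (by linarith)]
    refine le_trans ?_ hsize
    gcongr
    exact le_max_right _ _
  set s := Real.sqrt q with hs
  have hs0 : 0 < s := Real.sqrt_pos.2 hq0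
  have hsq : s ^ 2 = q := Real.sq_sqrt hq0.le
  have hs1 : s ≤ 1 := Real.sqrt_le_one.2 hq1
  have hAs : A * s ≤ 1 := by
    have : (A * s) ^ 2 ≤ 1 := by rw [mul_pow, hsq]; exact hAq
    exact (sq_le_one_iff₀ (by positivity)).1 this
  have hms : 2 / 3 / (m : ℝ) ≤ s := by
    apply Real.le_sqrt_of_sq_le
    rw [hq, div_pow, div_le_div_iff₀ (by positivity) (by positivity)]
    have h1 : (2 / 3 : ℝ) * (2 / 3) ≤ k * Real.log R * Real.log m := by
      have : (2 / 3 : ℝ) ≤ k * Real.log R := by nlinarith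
      gcongr
    have h2 : (m : ℝ) ≤ m ^ 2 := by nlinarith
    calc (2 / 3 : ℝ) ^ 2 * m ≤ (2 / 3 : ℝ) ^ 2 * m ^ 2 := by gcongr
      _ ≤ _ := by rw [sq (2 / 3 : ℝ)]; gcongr
  obtain ⟨W, hWr, hWnet, hWcard⟩ := exists_finset_net_range hLip hn hL hr hq0
  have hW1 : ∀ w ∈ W, ‖w‖ = 1 := fun w hw => by
    obtain ⟨z, hz, rfl⟩ := hWr w hw; exact hG z hz
  have hent : (W.card : ℝ) ^ 2 * m ≤ Real.exp (m * (20 * s * min s (1 / Real.log m))) := by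
    have h1 := two_mul_entropy_add_log_le hk hm2 hR hq hq1 hs0 hsq
    refine le_trans ?_ (Real.exp_le_exp.2 h1)
    have hpos : 0 < 1 + 2 * R / q := by positivity
    rw [Real.exp_add, Real.exp_log (by linarith)]
    gcongr
    rw [two_mul, Real.exp_add, ← sq, Real.exp_nat_mul, Real.exp_log hpos]
    gcongr
  have hgood := measure_not_approx_le (X := fun i ω => (a i ω, ξ i ω)) hn hm2 hx1 hf hKy hsub hcov
    hlaw hind W hW1 hs0 hms hent
  have hνK : ν ≤ 132 * Ky := hcov ▸ covariance_simObs_le hx1 hf hKy hsub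
  refine (measure_mono fun ω hω => ?_).trans
    (hgood.trans (ENNReal.ofReal_le_ofReal (by gcongr; norm_num)))
  simp only [Set.mem_ofPred_eq] at hω ⊢
  rintro ⟨hVT, hV⟩
  apply hω
  intro w hw t₀ ht₀ hct₀ t ht
  -- iterates and signal are unit vectors, so larger `c₀` never occur
  have hc1 : c₀ ≤ 1 := by
    refine hct₀.trans ((real_inner_le_norm _ _).trans ?_)
    obtain ⟨z, hz, h⟩ := hw.mem_range ht₀
    rw [hx1, ← h, hG z hz, mul_one]
  -- one step from any iterate with correlation at least `c₀ / 2`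
  have hstep : ∀ t, 1 ≤ t → c₀ / 2 ≤ ⟪x, w t⟫ → ‖w (t + 1) - x‖ ≤ A * s := by
    intro t ht hct
    refine (norm_sub_le_of_isRangeProj (δ := q / n) (T := 31000 * Ky * n) _ hG hx hW1 hWnet hKy hν
      hνK (by positivity : 0 < c₀ / 2) (by linarith) hs0 hs1 (by positivity) ?_ (by positivity) ?_
      hVT hV (hw.mem_range ht) hct (hw t)).trans_eq ?_
    · rw [hsq]; exact div_le_self hq0.le hn'
    · rw [hsq]; exact le_of_eq (by field_simp)
    · rw [hA]; field_simp; norm_num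
  -- being within distance `1` of `x` is correlation at least `1 / 2`
  have hcorr : ∀ t, 1 ≤ t → ‖w t - x‖ ≤ A * s → c₀ / 2 ≤ ⟪x, w t⟫ := by
    intro t ht hd
    obtain ⟨z, hz, h⟩ := hw.mem_range ht
    have hw1 : ‖w t‖ = 1 := by rw [← h]; exact hG z hz
    have h1 := pow_le_pow_left₀ (norm_nonneg _) (hd.trans hAs) 2
    rw [norm_sub_sq_real, hw1, hx1, real_inner_comm] at h1
    linarith
  induction t, ht using Nat.le_induction with
  | base => exact hstep t₀ ht₀ (by linarith)
  | succ t ht ih =>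
    have ht1 : 1 ≤ t := by simp only [Nat.succ_eq_add_one] at ht; omega
    exact hstep t ht1 (hcorr t ht1 ih)
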